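/- **Definitions.** A *tree* is a finite connected simple graph without cycles; $\mathrm{val}(v)$ is the number of edges containing the vertex $v$; vertices of valence $1$ are *leaves*, the others are *internal*. A tree is regarded as the disjoint union of its set of vertices and its set of edges. A *trees map* sends vertices to vertices and an edge $\{v,w\}$ to the edge $\{F(v),F(w)\}$. Let $Y$ and $Z$ be finite sets with at least three elements. A (topological) *tree of spheres* $\mathcal T^X$ marked by $X$ consists of a tree $T^X$ whose leaves are the elements of $X$ and, for each internal vertex $v$, a topological $2$-sphere $\mathcal S_v$ and an injective map $i_v$ from the set $E_v$ of edges at $v$ to $\mathcal S_v$; the points of $X_v=i_v(E_v)$ are the attaching points. A *cover between trees of spheres* $\mathcal F:\mathcal T^Y\to\mathcal T^Z$ consists of a trees map $F:T^Y\to T^Z$ sending leaves to leaves and internal vertices to internal vertices and, for each internal vertex $v$ of $T^Y$ with $w=F(v)$, a topological branched covering $f_v:\mathcal S_v\to\mathcal S_w$ (a continuous surjection locally of the form $z\mapsto z^d$, where $d\ge 1$ is the local degree) such that - (a) $f_v$ restricts to a covering $\mathcal S_v\setminus Y_v\to\mathcal S_w\setminus Z_w$; - (b) $f_v\circ i_v=i_w\circ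 F$ on $E_v$; - (c) for an edge $e=\{v_1,v_2\}$ between internal vertices, the local degree of $f_{v_1}$ at $i_{v_1}(e)$ equals the local degree of $f_{v_2}$ at $i_{v_2}(e)$. For an internal vertex $v$ of $T^Y$ put $\deg(v)=\deg(f_v)$ (the number of preimages of a generic point). For a leaf $y\in Y$, let $e$ be its edge and $v$ the internal vertex on $e$, and let $\deg(y)$ be the local degree of $f_v$ at $i_v(e)$. The leaf $y$ is *critical* if $\deg(y)>1$, and $\mathrm{mult}(y)=\deg(y)-1$. For a set $A$ of vertices and edges of a tree $T$, put $\chi_T(A)=\sum_{v\text{ a vertex in }A}(2-\mathrm{val}(v))$, with valences taken in $T$. **Proposition 2.22 (Riemann–Hurwitz formula).** Let $\mathcal F:\mathcal T^Y\to\mathcal T^Z$ be a cover between trees of spheres. The number $D=\sum_{v\in F^{-1}(w)}\deg(v)$ is the same for every vertex $w$ of $T^Z$; it is called the degree of $\mathcal F$. For every sub-graph $T''$ of $T^Z$ (more generally, every set $T''$ of vertices and edges of $T^Z$), with $T'=F^{-1}(T'')$, $$\chi_{T^Y}(T')=D\cdot\chi_{T^Z}(T'')-\sum_{y\in T'\text{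 a critical leaf}}\mathrm{mult}(y).$$ -/

import Mathlib

/-! ### Topological branched coverings of surfaces -/

section Branched

variable {S S' : Type*} [TopologicalSpace S] [TopologicalSpace S']

/-- In suitable local complex charts centred at `x` and at `f x`, the map `f` reads `z ↦ z ^ d`. -/
def HasPowerForm (f : S → S') (x : S) (d : ℕ) : Prop :=
  ∃ (φ : OpenPartialHomeomorph S ℂ) (ψ : OpenPartialHomeomorph S' ℂ),
    x ∈ φ.source ∧ φ x = 0 ∧ f x ∈ ψ.source ∧ ψ (f x) = 0 ∧
    Set.MapsTo f φ.source ψ.source ∧ ∀ y ∈ φ.source, ψ (f y) = φ y ^ d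

/-- A topological branched covering between compact surfaces: a continuous surjection which
is, around every point and up to local homeomorphisms, of the form `z ↦ z ^ d` with `d ≥ 1`. -/
structure IsBranchedCovering (f : S → S') : Prop where
  continuous : Continuous f
  surjective : Function.Surjective f
  powerForm : ∀ x, ∃ d, 0 < d ∧ HasPowerForm f x d

/-- The local degree `deg_x f` of a branched covering at `x`: the exponent `d ≥ 1` of its local
form `z ↦ z ^ d` (this exponent is unique). -/
noncomputable def localDegree (f : S → S') (x : S) : ℕ :=
  sInf {d | 0 < d ∧ HasPowerForm f x d}

/-- The degree of a branched covering between compact connected surfaces: the number of preimages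
of a generic point, that is, the maximal number of preimages of a point. -/
noncomputable def branchedDegree (f : S → S') : ℕ :=
  ⨆ w : S', (f ⁻¹' {w}).ncard

end Branched

/-! ### Trees of spheres -/

set_option linter.checkUnivs false in
/-- A topological tree of spheres marked by the finite set `X` with at least three elements:
a finite tree whose leaves (the vertices of valence one) are the elements of `X`, for every
other vertex `v` a topological sphere `sphere v`, and an injective map `attach v` from the set
of edges at `v` to `sphere v`. An edge `{v, w}` at `v` is given by its other end `w`. -/
structure TreeOfSpheres.{u, v, w} (X : Type u) [Fintype X] where
  three_le_card : 3 ≤ Fintype.card X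
  V : Type v
  [fintypeV : Fintype V]
  graph : SimpleGraph V
  isTree : graph.IsTree
  /-- The leaf labelled by an element of `X`. -/
  leaf : X → V
  leaf_injective : Function.Injective leaf
  range_leaf : Set.range leaf = {v | (graph.neighborSet v).ncard = 1}
  sphere : {v : V // (graph.neighborSet v).ncard ≠ 1} → Type w
  [topology : ∀ v, TopologicalSpace (sphere v)]
  isSphere : ∀ v, Nonempty (sphere v ≃ₜ Metric.sphere (0 : EuclideanSpace ℝ (Fin 3)) 1)
  attach : ∀ v, graph.neighborSet v.1 → sphere v
  attach_injective : ∀ v, Function.Injective (attach v)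

namespace TreeOfSpheres

attribute [instance] TreeOfSpheres.fintypeV TreeOfSpheres.topology

variable {X : Type*} [Fintype X] (T : TreeOfSpheres X)

/-- The valence of a vertex: the number of edges containing it. -/
noncomputable def val (v : T.V) : ℕ := (T.graph.neighborSet v).ncard

/-- Leaves are the vertices of valence one. -/
def IsLeaf (v : T.V) : Prop := T.val v = 1

/-- Internal vertices are the vertices which are not leaves. -/
abbrev IV : Type _ := {v : T.V // (T.graph.neighborSet v).ncard ≠ 1}

/-- The tree as the disjoint union of its set of vertices and its set of edges. -/
abbrev Total : Type _ := T.V ⊕ T.graph.edgeSet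

/-- The set of attaching points on the sphere at an internal vertex. -/
def attachingPoints (v : T.IV) : Set (T.sphere v) := Set.range (T.attach v)

open Classical in
/-- The characteristic of a set of vertices and edges of `T`: the sum of `2 - val v` over the
vertices `v` in it, with the valences taken in `T`. -/
noncomputable def char (A : Set T.Total) : ℤ :=
  ∑ v : T.V with Sum.inl v ∈ A, (2 - (T.val v : ℤ))

/-- A leaf is connected to an internal vertex by an edge. -/
theorem exists_internal_adj (v : T.V) (hv : T.IsLeaf v) : ∃ w : T.IV, T.graph.Adj w.1 v := by
  obtain ⟨w, hw⟩ := Set.ncard_eq_one.mp hv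
  have hvw : T.graph.Adj v w := by
    have : w ∈ T.graph.neighborSet v := by rw [hw]; rfl
    exact this
  refine ⟨⟨w, fun h => ?_⟩, hvw.symm⟩
  obtain ⟨v', hv'⟩ := Set.ncard_eq_one.mp h
  have hvv' : v = v' := by
    have : v ∈ T.graph.neighborSet w := hvw.symm
    rw [hv'] at this
    exact this
  subst hvv'
  have key : ∀ a b : T.V, T.graph.Walk a b → (a = v ∨ a = w) → (b = v ∨ b = w) := by
    intro a b p
    induction p with
    | nil => exact id
    | @cons a c b hac p ih =>
      intro ha
      refine ih ?_
      rcases ha with rfl | rfl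
      · have : c ∈ T.graph.neighborSet a := hac
        rw [hw] at this
        exact Or.inr this
      · have : c ∈ T.graph.neighborSet a := hac
        rw [hv'] at this
        exact Or.inl this
  classical
  have hall : (Finset.univ : Finset T.V) ⊆ {v, w} := by
    intro b _
    obtain ⟨p⟩ := T.isTree.connected.preconnected v b
    have := key v b p (Or.inl rfl)
    simpa using this
  have h1 := Finset.card_le_card hall
  have h2 := Fintype.card_le_of_injective T.leaf T.leaf_injective
  have h3 := T.three_le_card
  have h4 : ({v, w} : Finset T.V).card ≤ 2 := Finset.card_le_two
  simp only [Finset.card_univ] at h1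
  omega

end TreeOfSpheres

/-! ### Covers between trees of spheres -/

/-- A cover between trees of spheres. -/
structure TreeOfSpheres.Cover {Y Z : Type*} [Fintype Y] [Fintype Z]
    (TY : TreeOfSpheres Y) (TZ : TreeOfSpheres Z) where
  /-- The underlying trees map. -/
  map : TY.graph →g TZ.graph
  map_leaf : ∀ v, TY.IsLeaf v → TZ.IsLeaf (map v)
  map_internal : ∀ v : TY.IV, (TZ.graph.neighborSet (map v.1)).ncard ≠ 1
  /-- The branched coverings between the spheres. -/
  f : ∀ v : TY.IV, TY.sphere v → TZ.sphere ⟨map v.1, map_internal v⟩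
  isBranchedCovering : ∀ v, IsBranchedCovering (f v)
  mapsTo_compl : ∀ v, Set.MapsTo (f v) (TY.attachingPoints v)ᶜ
    (TZ.attachingPoints ⟨map v.1, map_internal v⟩)ᶜ
  isCoveringMap : ∀ v, IsCoveringMap (mapsTo_compl v).restrict
  f_attach : ∀ (v : TY.IV) (w : TY.V) (h : TY.graph.Adj v.1 w),
    f v (TY.attach v ⟨w, h⟩) = TZ.attach ⟨map v.1, map_internal v⟩ ⟨map w, map.map_adj h⟩
  /-- On an edge between two internal vertices, the local degrees at both ends agree. -/
  localDegree_eq : ∀ (v w : TY.IV) (h : TY.graph.Adj v.1 w.1),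
    localDegree (f v) (TY.attach v ⟨w.1, h⟩) = localDegree (f w) (TY.attach w ⟨v.1, h.symm⟩)

namespace TreeOfSpheres.Cover

variable {Y Z : Type*} [Fintype Y] [Fintype Z] {TY : TreeOfSpheres Y} {TZ : TreeOfSpheres Z}
  (F : TreeOfSpheres.Cover TY TZ)

/-- The trees map on vertices and edges. -/
def totalMap : TY.Total → TZ.Total := Sum.map F.map F.map.mapEdgeSet

/-- The degree of a leaf `v`: the local degree at the attaching point of the edge at `v` on the
sphere of the (unique) vertex to which `v` is connected. -/
noncomputable def leafDegree (v : TY.V) (hv : TY.IsLeaf v) : ℕ :=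
  localDegree (F.f (TY.exists_internal_adj v hv).choose)
    (TY.attach (TY.exists_internal_adj v hv).choose
      ⟨v, (TY.exists_internal_adj v hv).choose_spec⟩)

open Classical in
/-- The degree of a vertex. -/
noncomputable def deg (v : TY.V) : ℕ :=
  if h : TY.IsLeaf v then F.leafDegree v h else branchedDegree (F.f ⟨v, h⟩)

open Classical in
/-- The number `D_w`: the sum of the degrees of the preimages of the vertex `w`. -/
noncomputable def degreeOver (w : TZ.V) : ℕ :=
  ∑ v : TY.V with F.map v = w, F.deg v

/-- The degree of the cover: the common value of the numbers `D_w`. -/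
noncomputable def degree : ℕ :=
  F.degreeOver (Classical.choice TZ.isTree.connected.nonempty)

/-- The leaf labelled by `y` is critical if its degree is more than one. -/
def IsCriticalLeaf (y : Y) : Prop := 1 < F.deg (TY.leaf y)

/-- The multiplicity of the leaf labelled by `y`. -/
noncomputable def mult (y : Y) : ℤ := (F.deg (TY.leaf y) : ℤ) - 1

end TreeOfSpheres.Cover

/-!
# The Riemann-Hurwitz formula for covers between trees of spheres

The formula holds vertex by vertex. Over a leaf it is the equality `1 = deg y - (deg y - 1)`, and at
an internal vertex `v` it says `2 - val v = deg v * (2 - val (F v))`, which is the multiplicativity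
of the Euler characteristic in the covering of the punctured sphere at `F v` by the punctured sphere
at `v` (`IsBranchedCovering.ncard_preimage`). Summing over the vertices of `T'` gives the statement,
once the sums of degrees over the fibers of the trees map are known to be constant. For adjacent
vertices these sums agree because both are the sum of the local degrees at the edges over the
given edge: this uses that the local degrees over any point of a sphere add up to the degree of the
branched covering (`IsBranchedCovering.finsum_localDegree`), a continuity argument based on the fact
that near a point the map `z ↦ z ^ d` takes each value other than the central one `d` times.

The multiplicativity of the Euler characteristic is obtained from the first Betti number, computed
in two ways. After stereographic projection, a covering `p` with `d` sheets goes from the plane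
minus a finite set `Q` to the plane minus a finite set `P`, and one can arrange that the points of
`P` have distinct real parts. Slitting the plane along the vertical rays which go down from the
points of `P`, respectively up, gives two contractible open sets whose union is the complement of
`P` and whose intersection consists of `|P| + 1` vertical strips. Over each slit plane the covering
is trivial, so the preimages of the two slit planes consist of `d` contractible sheets each, and
meet in `d * (|P| + 1)` strips. By the Mayer-Vietoris sequence (`finrank_firstCohomology`) the first
Betti number of the source is `d * (|P| + 1) - 2 * d + 1`. For the identity of the complement of `Q`
the same computation gives `|Q|` (`IsCoveringMap.card_punctures`).

First cohomology is taken in the guise of continuous maps to the circle modulo those which lift to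
`ℝ`. In this form the part of the Mayer-Vietoris sequence which is needed follows from Urysohn's
lemma.
-/

open Topology Set

/-! ### Local degrees of branched coverings -/

lemma ncard_setOf_pow_eq {d : ℕ} (hd : 0 < d) {c : ℂ} (hc : c ≠ 0) :
    {z : ℂ | z ^ d = c}.ncard = d := by
  have hsep : (Polynomial.X ^ d - Polynomial.C c).Separable :=
    Polynomial.separable_X_pow_sub_C c (by exact_mod_cast hd.ne') hc
  have h := Polynomial.card_rootSet_eq_natDegree hsep (K := ℂ)
    (IsAlgClosed.splits _)
  rw [Polynomial.natDegree_X_pow_sub_C, ← Nat.card_eq_fintype_card, Nat.card_coe_set_eq] at h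
  refine Eq.trans (congrArg Set.ncard (Set.ext fun z => ?_)) h
  rw [Polynomial.mem_rootSet_of_ne (Polynomial.X_pow_sub_C_ne_zero hd c)]
  simp [sub_eq_zero]

section LocalDegree

variable {S S' : Type*} [TopologicalSpace S] [TopologicalSpace S'] {f : S → S'} {x : S} {d : ℕ}

/-- The exponent of a power form is the number of preimages close to `x` of a point close
to `f x`. -/
lemma HasPowerForm.eventually_ncard (h : HasPowerForm f x d) (hd : 0 < d) :
    ∀ᶠ N in (𝓝 x).smallSets, N ∈ 𝓝 x →
      ∀ᶠ w in 𝓝[≠] f x, (N ∩ f ⁻¹' {w}).ncard = d := by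
  obtain ⟨φ, ψ, hxφ, hφx, hfψ, hψ, hmaps, hform⟩ := h
  rw [Filter.eventually_smallSets]
  refine ⟨φ.source, φ.open_source.mem_nhds hxφ, fun N hN hNx => ?_⟩
  have h0 : (0 : ℂ) ∈ φ.target := hφx ▸ φ.map_source hxφ
  have hsymm : φ.symm 0 = x := hφx ▸ φ.left_inv hxφ
  have hpre : φ.target ∩ φ.symm ⁻¹' N ∈ 𝓝 (0 : ℂ) := by
    refine Filter.inter_mem (φ.open_target.mem_nhds h0) ?_
    exact (φ.continuousAt_symm h0).preimage_mem_nhds (hsymm.symm ▸ hNx)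
  obtain ⟨ε, hε, hball⟩ := Metric.mem_nhds_iff.mp hpre
  have hψsmall : ∀ᶠ w in 𝓝 (f x), ‖ψ w‖ < ε ^ d := by
    have := (ψ.continuousAt hfψ).norm
    refine this.eventually_lt continuousAt_const ?_
    simpa [hψ] using pow_pos hε d
  rw [eventually_nhdsWithin_iff]
  filter_upwards [ψ.open_source.mem_nhds hfψ, hψsmall] with w hw hwε hne
  have hc : ψ w ≠ 0 := fun h => hne (ψ.injOn hw hfψ (h.trans hψ.symm))
  rw [← ncard_setOf_pow_eq hd hc]
  have hroot : ∀ z : ℂ, z ^ d = ψ w → z ∈ φ.target ∩ φ.symm ⁻¹' N := fun z hz => hball <| by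
    rw [mem_ball_zero_iff]
    rw [← hz, norm_pow] at hwε
    exact lt_of_pow_lt_pow_left₀ d hε.le hwε
  have himage : N ∩ f ⁻¹' {w} = φ.symm '' {z | z ^ d = ψ w} := by
    ext y
    constructor
    · rintro ⟨hyN, hy⟩
      exact ⟨φ y, by rw [mem_ofPred_eq, ← hform y (hN hyN), show f y = w from hy],
        φ.left_inv (hN hyN)⟩
    · rintro ⟨z, hz, rfl⟩
      obtain ⟨hzt, hzN⟩ := hroot z hz
      refine ⟨hzN, ψ.injOn (hmaps (φ.map_target hzt)) hw ?_⟩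
      rw [hform _ (φ.map_target hzt), φ.right_inv hzt, hz]
  rw [himage]
  exact (φ.symm.injOn.mono fun z hz => (hroot z hz).1).ncard_image

lemma HasPowerForm.unique [(𝓝[≠] f x).NeBot] {d' : ℕ} (h : HasPowerForm f x d) (hd : 0 < d)
    (h' : HasPowerForm f x d') (hd' : 0 < d') : d = d' := by
  obtain ⟨N, hN, hNx⟩ := ((h.eventually_ncard hd).and
    (h'.eventually_ncard hd')).exists_mem_of_smallSets
  obtain ⟨w, hw, hw'⟩ := ((hNx.1 hN).and (hNx.2 hN)).exists
  exact hw.symm.trans hw'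

lemma HasPowerForm.localDegree_eq [(𝓝[≠] f x).NeBot] (h : HasPowerForm f x d) (hd : 0 < d) :
    localDegree f x = d := by
  have : {d | 0 < d ∧ HasPowerForm f x d} = {d} := by
    ext d'
    exact ⟨fun h' => h'.2.unique h'.1 h hd, fun h' => h' ▸ ⟨hd, h⟩⟩
  rw [localDegree, this, csInf_singleton]

lemma IsBranchedCovering.localDegree_spec (h : IsBranchedCovering f) (x : S) :
    0 < localDegree f x ∧ HasPowerForm f x (localDegree f x) :=
  Nat.sInf_mem (h.powerForm x)

/-- Where it is injective, a branched covering has local degree one. -/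
lemma IsBranchedCovering.localDegree_eq_one [(𝓝[≠] f x).NeBot] (h : IsBranchedCovering f)
    {N : Set S} (hN : N ∈ 𝓝 x) (hinj : InjOn f N) : localDegree f x = 1 := by
  obtain ⟨hd, hform⟩ := h.localDegree_spec x
  obtain ⟨M, hM, hMx⟩ := ((hform.eventually_ncard hd).and
    (Filter.eventually_smallSets_subset.mpr hN)).exists_mem_of_smallSets
  obtain ⟨w, hw⟩ := (hMx.1 hM).exists
  have : (M ∩ f ⁻¹' {w}).ncard ≤ 1 := by
    refine (ncard_le_one (finite_of_ncard_pos (hw ▸ hd))).mpr fun a ha b hb => ?_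
    exact hinj (hMx.2 ha.1) (hMx.2 hb.1) (ha.2.trans hb.2.symm)
  omega

lemma IsBranchedCovering.finite_fiber [CompactSpace S] [T1Space S'] (h : IsBranchedCovering f)
    (w : S') : (f ⁻¹' {w}).Finite := by
  refine (isClosed_singleton.preimage h.continuous).isCompact.finite ?_
  rw [isDiscrete_iff_forall_mem_exists_isOpen]
  intro x hx
  obtain ⟨d, hd, φ, ψ, hxφ, hφx, -, hψ, -, hform⟩ := h.powerForm x
  refine ⟨φ.source, φ.open_source, ?_⟩
  ext y
  constructor
  · rintro ⟨hy, hyw⟩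
    have h1 := hform y hy
    rw [show f y = f x from hyw.trans hx.symm, hψ] at h1
    exact φ.injOn hy hxφ ((pow_eq_zero_iff hd.ne').mp h1.symm |>.trans hφx.symm)
  · rintro rfl
    exact ⟨hxφ, hx⟩

/-- Near a value `w`, every other value has as many preimages as `w` has with multiplicity. -/
lemma IsBranchedCovering.eventually_ncard_fiber [CompactSpace S] [T2Space S] [T2Space S']
    (h : IsBranchedCovering f) (w : S') :
    ∀ᶠ w' in 𝓝[≠] w, (f ⁻¹' {w'}).ncard = ∑ᶠ x ∈ f ⁻¹' {w}, localDegree f x := by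
  have hfin := h.finite_fiber w
  obtain ⟨U, hU, hdisj⟩ := hfin.t2_separation
  have hN : ∀ x ∈ f ⁻¹' {w}, ∃ N ∈ 𝓝 x, N ⊆ U x ∧
      ∀ᶠ w' in 𝓝[≠] w, (N ∩ f ⁻¹' {w'}).ncard = localDegree f x := by
    rintro x rfl
    obtain ⟨hd, hform⟩ := h.localDegree_spec x
    obtain ⟨M, hM, hMx⟩ := ((hform.eventually_ncard hd).and
      (Filter.eventually_smallSets_subset.mpr ((hU x).2.mem_nhds (hU x).1))).exists_mem_of_smallSets
    exact ⟨M, hM, hMx.2, hMx.1 hM⟩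
  choose! N hNx hNU hNcard using hN
  -- `f` is closed, so fibers close to the one over `w` lie in the union of the `N x`.
  have hclosed : ∀ᶠ w' in 𝓝 w, f ⁻¹' {w'} ⊆ ⋃ x ∈ f ⁻¹' {w}, N x := by
    have hopen : ∀ x ∈ f ⁻¹' {w}, x ∈ interior (N x) := fun x hx =>
      mem_interior_iff_mem_nhds.mpr (hNx x hx)
    have hO : IsOpen (⋃ x ∈ f ⁻¹' {w}, interior (N x)) :=
      isOpen_biUnion fun _ _ => isOpen_interior
    have himg := h.continuous.isClosedMap _ hO.isClosed_compl
    have hw : w ∈ (f '' (⋃ x ∈ f ⁻¹' {w}, interior (N x))ᶜ)ᶜ := by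
      rintro ⟨y, hy, hyw⟩
      exact hy (mem_biUnion hyw (hopen y hyw))
    filter_upwards [himg.isOpen_compl.mem_nhds hw] with w' hw' y hy
    by_contra hcon
    refine hw' ⟨y, fun hy' => hcon ?_, hy⟩
    exact iUnion₂_mono (fun x _ => interior_subset) hy'
  have hall : ∀ᶠ w' in 𝓝[≠] w, ∀ x ∈ f ⁻¹' {w}, (N x ∩ f ⁻¹' {w'}).ncard = localDegree f x :=
    (hfin.eventually_all).mpr fun x hx => hNcard x hx
  filter_upwards [hall, nhdsWithin_le_nhds hclosed] with w' hcard hsub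
  have heq : f ⁻¹' {w'} = ⋃ x ∈ f ⁻¹' {w}, N x ∩ f ⁻¹' {w'} := by
    rw [← iUnion₂_inter, inter_eq_right.mpr hsub]
  have hpd : (f ⁻¹' {w}).PairwiseDisjoint fun x => N x ∩ f ⁻¹' {w'} := fun a ha b hb hab =>
    (hdisj ha hb hab).mono (inter_subset_left.trans (hNU a ha))
      (inter_subset_left.trans (hNU b hb))
  rw [heq, hfin.ncard_biUnion (fun x _ => (h.finite_fiber w').subset inter_subset_right) hpd]
  exact finsum_mem_congr rfl hcard

/-- The sum of the local degrees over a fiber of a branched covering is its degree, provided that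
the branch values are contained in a finite set. -/
theorem IsBranchedCovering.finsum_localDegree [CompactSpace S] [T2Space S] [T2Space S']
    [ConnectedSpace S'] [Nontrivial S'] (h : IsBranchedCovering f) {Z : Set S'} (hZ : Z.Finite)
    (hloc : ∀ x, f x ∉ Z → localDegree f x = 1) (w : S') :
    ∑ᶠ x ∈ f ⁻¹' {w}, localDegree f x = branchedDegree f := by
  have hcount : ∀ w, w ∉ Z → ∑ᶠ x ∈ f ⁻¹' {w}, localDegree f x = (f ⁻¹' {w}).ncard := by
    intro w hw
    rw [← finsum_one]
    exact finsum_mem_congr rfl fun x hx => hloc x (by rwa [show f x = w from hx])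
  have hZev : ∀ w : S', ∀ᶠ w' in 𝓝[≠] w, w' ∉ Z := fun w => by
    have : (Z \ {w})ᶜ ∈ 𝓝 w := (hZ.subset sdiff_subset).isClosed.isOpen_compl.mem_nhds (by simp)
    filter_upwards [nhdsWithin_le_nhds this, self_mem_nhdsWithin] with w' h1 h2 h3
    exact h1 ⟨h3, h2⟩
  have hconst : IsLocallyConstant fun w => ∑ᶠ x ∈ f ⁻¹' {w}, localDegree f x := by
    rw [IsLocallyConstant.iff_eventually_eq]
    intro w
    have : ∀ᶠ w' in 𝓝[≠] w, ∑ᶠ x ∈ f ⁻¹' {w'}, localDegree f x =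
        ∑ᶠ x ∈ f ⁻¹' {w}, localDegree f x := by
      filter_upwards [hZev w, h.eventually_ncard_fiber w] with w' h1 h2
      rw [hcount w' h1, h2]
    rw [eventually_nhdsWithin_iff] at this
    filter_upwards [this] with w' hw'
    by_cases hww : w' = w
    · rw [hww]
    · exact hw' hww
  have hle : ∀ w', (f ⁻¹' {w'}).ncard ≤ ∑ᶠ x ∈ f ⁻¹' {w}, localDegree f x := by
    intro w'
    rw [hconst.apply_eq_of_preconnectedSpace w w', ← finsum_one]
    rw [finsum_mem_eq_finite_toFinset_sum _ (h.finite_fiber w'),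
      finsum_mem_eq_finite_toFinset_sum _ (h.finite_fiber w')]
    exact Finset.sum_le_sum fun x _ => (h.localDegree_spec x).1
  obtain ⟨w₀, hw₀⟩ := (hZev w).exists
  refine le_antisymm ?_ (ciSup_le' hle)
  rw [hconst.apply_eq_of_preconnectedSpace w w₀, hcount w₀ hw₀]
  exact le_ciSup (f := fun w => (f ⁻¹' {w}).ncard) ⟨_, forall_mem_range.mpr hle⟩ w₀

end LocalDegree

/-! ### Integral first cohomology and the Mayer-Vietoris sequence -/

section FirstCohomology

/-- The subgroup of those maps to the circle which lift to real-valued continuous functions. -/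
noncomputable def liftableMaps (W : Type*) [TopologicalSpace W] :
    AddSubgroup C(W, UnitAddCircle) where
  carrier := {g | ∃ h : C(W, ℝ), ∀ x, (h x : UnitAddCircle) = g x}
  zero_mem' := ⟨0, fun x => by simp⟩
  add_mem' := by
    rintro g g' ⟨h, hh⟩ ⟨h', hh'⟩
    exact ⟨h + h', fun x => by simp [hh, hh']⟩
  neg_mem' := by
    rintro g ⟨h, hh⟩
    exact ⟨-h, fun x => by simp [hh]⟩

/-- The first integral cohomology group, in the guise of continuous maps to the circle
modulo those which lift to `ℝ`. -/
abbrev FirstCohomology (W : Type*) [TopologicalSpace W] : Type _ :=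
  C(W, UnitAddCircle) ⧸ liftableMaps W

/-- Every map from `W` to the circle lifts to `ℝ` on the subset `A`. This is weaker than the
vanishing of the first cohomology of `A`, as only maps defined on all of `W` are concerned. -/
def LiftsOn {W : Type*} [TopologicalSpace W] (A : Set W) : Prop :=
  ∀ g : C(W, UnitAddCircle), ∃ h : W → ℝ, ContinuousOn h A ∧ ∀ x ∈ A, (h x : UnitAddCircle) = g x

/-- The space `X` is the disjoint union of nonempty connected open pieces indexed by `ι`. -/
def HasPieces (X ι : Type*) [TopologicalSpace X] : Prop :=
  ∃ c : X → ι, IsLocallyConstant c ∧ ∀ i, IsConnected (c ⁻¹' {i})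

lemma HasPieces.nonempty_linearEquiv {X ι : Type*} [TopologicalSpace X] (h : HasPieces X ι) :
    Nonempty ((ι → ℤ) ≃ₗ[ℤ] LocallyConstant X ℤ) := by
  obtain ⟨c, hc, hconn⟩ := h
  let e : (ι → ℤ) →ₗ[ℤ] LocallyConstant X ℤ :=
    { toFun := fun u => ⟨u ∘ c, hc.comp u⟩
      map_add' := fun _ _ => rfl
      map_smul' := fun _ _ => rfl }
  refine ⟨LinearEquiv.ofBijective e ⟨fun u u' huu => ?_, fun n => ?_⟩⟩
  · ext i
    obtain ⟨x, hx⟩ := (hconn i).nonempty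
    have : u (c x) = u' (c x) := DFunLike.congr_fun huu x
    rwa [show c x = i from hx] at this
  · choose s hs using fun i => (hconn i).nonempty
    refine ⟨fun i => n (s i), ?_⟩
    ext x
    exact n.isLocallyConstant.apply_eq_of_isPreconnected (hconn (c x)).isPreconnected
      (hs (c x)) rfl

lemma exists_sub_eq_intCast {a b : ℝ} (h : (a : UnitAddCircle) = b) : ∃ m : ℤ, a - b = m := by
  have h0 : ((a - b : ℝ) : UnitAddCircle) = 0 := by rw [AddCircle.coe_sub, h, sub_self]
  obtain ⟨m, hm⟩ := (AddCircle.coe_eq_zero_iff 1).mp h0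
  exact ⟨m, by simpa using hm.symm⟩

lemma coe_intCast_unitAddCircle (m : ℤ) : ((m : ℝ) : UnitAddCircle) = 0 :=
  (AddCircle.coe_eq_zero_iff 1).mpr ⟨m, by simp⟩

variable {W : Type*} [TopologicalSpace W] {A B : Set W}

lemma continuous_of_continuousOn_cover {Y : Type*} [TopologicalSpace Y] {f : W → Y}
    (hA : IsOpen A) (hB : IsOpen B) (hAB : A ∪ B = univ) (hfA : ContinuousOn f A)
    (hfB : ContinuousOn f B) : Continuous f := by
  rw [continuous_iff_continuousAt]
  intro x
  rcases (hAB ▸ mem_univ x : x ∈ A ∪ B) with h | h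
  · exact hfA.continuousAt (hA.mem_nhds h)
  · exact hfB.continuousAt (hB.mem_nhds h)

/-- An integer-valued continuous real function on `A`, as a locally constant function. -/
lemma exists_locallyConstant_of_continuousOn {k : W → ℝ} (hk : ContinuousOn k A)
    (hint : ∀ x ∈ A, ∃ m : ℤ, k x = m) :
    ∃ n : LocallyConstant A ℤ, ∀ x : A, (n x : ℝ) = k x := by
  choose m hm using fun x : A => hint x x.2
  refine ⟨⟨m, (IsLocallyConstant.iff_continuous m).mpr ?_⟩, fun x => (hm x).symm⟩
  rw [Int.isClosedEmbedding_coe_real.isEmbedding.continuous_iff]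
  exact hk.domRestrict.congr hm

/-- A function which is `0` close to the complement of `B` and `1` close to the complement
of `A`. -/
lemma exists_cutoff [NormalSpace W] (hA : IsOpen A) (hB : IsOpen B) (hAB : A ∪ B = univ) :
    ∃ ρ : C(W, ℝ), (∀ x ∉ B, ρ =ᶠ[𝓝 x] 0) ∧ ∀ x ∉ A, ρ =ᶠ[𝓝 x] 1 := by
  obtain ⟨g, hg0, hg1, -⟩ := exists_continuous_zero_one_of_isClosed hB.isClosed_compl
    hA.isClosed_compl (disjoint_compl_left_iff_subset.mpr
      fun x hx => (hAB ▸ mem_univ x : x ∈ A ∪ B).resolve_left hx)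
  refine ⟨⟨fun x => max 0 (min 1 (3 * g x - 1)), by fun_prop⟩, fun x hx => ?_, fun x hx => ?_⟩
  · have : ∀ᶠ y in 𝓝 x, g y < 1 / 3 :=
      g.continuous.continuousAt.eventually_lt continuousAt_const (by simp [hg0 hx])
    filter_upwards [this] with y hy
    exact max_eq_left ((min_le_right _ _).trans (by linarith))
  · have : ∀ᶠ y in 𝓝 x, 2 / 3 < g y :=
      continuousAt_const.eventually_lt g.continuous.continuousAt (by norm_num [hg1 hx])
    filter_upwards [this] with y hy
    change max 0 (min 1 (3 * g y - 1)) = 1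
    rw [min_eq_left (by linarith)]
    simp

open Classical in
/-- A locally constant function on a subset, as a real function extended by zero. -/
noncomputable def extendByZero {C : Set W} (n : LocallyConstant C ℤ) (x : W) : ℝ :=
  if h : x ∈ C then (n ⟨x, h⟩ : ℝ) else 0

lemma extendByZero_of_mem {C : Set W} (n : LocallyConstant C ℤ) {x : W} (h : x ∈ C) :
    extendByZero n x = n ⟨x, h⟩ := dif_pos h

lemma extendByZero_add {C : Set W} (n n' : LocallyConstant C ℤ) (x : W) :
    extendByZero (n + n') x = extendByZero n x + extendByZero n' x := by
  by_cases h : x ∈ C <;> simp [extendByZero, h]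

lemma coe_extendByZero {C : Set W} (n : LocallyConstant C ℤ) (x : W) :
    (extendByZero n x : UnitAddCircle) = 0 := by
  by_cases h : x ∈ C
  · rw [extendByZero_of_mem n h, coe_intCast_unitAddCircle]
  · simp [extendByZero, h]

lemma continuousOn_mul_extendByZero {C : Set W} (hC : IsOpen C) (n : LocallyConstant C ℤ)
    {r : W → ℝ} (hr : Continuous r) {D : Set W} (hD : ∀ x ∈ D, x ∉ C → r =ᶠ[𝓝 x] 0) :
    ContinuousOn (fun x => r x * extendByZero n x) D := by
  intro x hx
  refine ContinuousAt.continuousWithinAt ?_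
  by_cases hxC : x ∈ C
  · refine hr.continuousAt.mul (ContinuousOn.continuousAt ?_ (hC.mem_nhds hxC))
    rw [continuousOn_iff_continuous_domRestrict]
    have : Continuous fun y : C => (n y : ℝ) := continuous_of_discreteTopology.comp n.continuous
    exact this.congr fun y => (extendByZero_of_mem n y.2).symm
  · refine (continuousAt_const (y := (0 : ℝ))).congr ?_
    filter_upwards [hD x hx hxC] with y hy
    simp [hy]

/-- The map to the circle which is `exp (2πi ρ n)` in multiplicative notation. It is continuous
because `ρ n` vanishes close to the complement of `B`, and `(ρ - 1) n`, which has the same class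
modulo `ℤ`, vanishes close to the complement of `A`. -/
noncomputable def connectingMap (hA : IsOpen A) (hB : IsOpen B) (hAB : A ∪ B = univ)
    (ρ : C(W, ℝ)) (h0 : ∀ x ∉ B, ρ =ᶠ[𝓝 x] 0) (h1 : ∀ x ∉ A, ρ =ᶠ[𝓝 x] 1)
    (n : LocallyConstant (A ∩ B : Set W) ℤ) : C(W, UnitAddCircle) where
  toFun x := (ρ x * extendByZero n x : ℝ)
  continuous_toFun := by
    refine continuous_of_continuousOn_cover hA hB hAB
      ((AddCircle.continuous_mk' (1 : ℝ)).comp_continuousOn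
        (continuousOn_mul_extendByZero (hA.inter hB) n ρ.continuous
          fun x hx hx' => h0 x fun h => hx' ⟨hx, h⟩)) ?_
    refine ((AddCircle.continuous_mk' (1 : ℝ)).comp_continuousOn
        (continuousOn_mul_extendByZero (hA.inter hB) n (r := fun x => ρ x - 1) (D := B)
          (by fun_prop) fun x hx hx' => ?_)).congr fun x _ => ?_
    · filter_upwards [h1 x fun h => hx' ⟨h, hx⟩] with y hy
      simp [hy]
    · change ((ρ x * extendByZero n x : ℝ) : UnitAddCircle) = ((ρ x - 1) * extendByZero n x : ℝ)
      rw [sub_one_mul, AddCircle.coe_sub, coe_extendByZero, sub_zero]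

end FirstCohomology

section MayerVietoris

variable {W : Type*} [TopologicalSpace W] {A B : Set W}

/-- The connecting homomorphism of the Mayer-Vietoris sequence, from the zeroth cohomology of
`A ∩ B` to the first cohomology of `A ∪ B = W`, by means of the cutoff function `ρ`. -/
noncomputable def connectingHom (hA : IsOpen A) (hB : IsOpen B) (hAB : A ∪ B = univ)
    (ρ : C(W, ℝ)) (h0 : ∀ x ∉ B, ρ =ᶠ[𝓝 x] 0) (h1 : ∀ x ∉ A, ρ =ᶠ[𝓝 x] 1) :
    LocallyConstant (A ∩ B : Set W) ℤ →ₗ[ℤ] FirstCohomology W :=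
  AddMonoidHom.toIntLinearMap <| (QuotientAddGroup.mk' (liftableMaps W)).comp <|
    AddMonoidHom.mk' (connectingMap hA hB hAB ρ h0 h1) fun n n' => by
      ext x
      change ((ρ x * extendByZero (n + n') x : ℝ) : UnitAddCircle) =
        (ρ x * extendByZero n x : ℝ) + (ρ x * extendByZero n' x : ℝ)
      rw [extendByZero_add, mul_add, AddCircle.coe_add]

/-- Restriction of locally constant functions. -/
noncomputable def restrictLocallyConstant {C D : Set W} (h : C ⊆ D) :
    LocallyConstant D ℤ →ₗ[ℤ] LocallyConstant C ℤ :=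
  LocallyConstant.comapₗ ℤ ⟨inclusion h, continuous_inclusion h⟩

/-- The difference of the restrictions from `A` and from `B` to `A ∩ B`. -/
noncomputable def restrictionDifference (A B : Set W) :
    (LocallyConstant A ℤ × LocallyConstant B ℤ) →ₗ[ℤ] LocallyConstant (A ∩ B : Set W) ℤ :=
  (restrictLocallyConstant inter_subset_left).comp (LinearMap.fst ℤ _ _) -
    (restrictLocallyConstant inter_subset_right).comp (LinearMap.snd ℤ _ _)

lemma restrictionDifference_apply (a : LocallyConstant A ℤ) (b : LocallyConstant B ℤ)
    (x : (A ∩ B : Set W)) :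
    restrictionDifference A B (a, b) x = a ⟨x, x.2.1⟩ - b ⟨x, x.2.2⟩ := rfl

lemma continuousOn_extendByZero {C : Set W} (hC : IsOpen C) (c : LocallyConstant C ℤ) :
    ContinuousOn (extendByZero c) C := by
  refine (continuousOn_mul_extendByZero hC c (continuous_const (y := (1 : ℝ)))
    (D := C) fun x hx hx' => absurd hx hx').congr fun x _ => ?_
  exact (one_mul _).symm

/-- Two continuous functions which agree on `A ∩ B` glue. -/
lemma exists_glue (hA : IsOpen A) (hB : IsOpen B) (hAB : A ∪ B = univ) {u v : W → ℝ}
    (hu : ContinuousOn u A) (hv : ContinuousOn v B) (huv : ∀ x ∈ A, x ∈ B → u x = v x) :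
    ∃ h : C(W, ℝ), (∀ x ∈ A, h x = u x) ∧ ∀ x ∈ B, h x = v x := by
  classical
  have hv' : ∀ x ∈ B, (if x ∈ A then u x else v x) = v x := fun x hx => by
    by_cases hxA : x ∈ A
    · rw [if_pos hxA, huv x hxA hx]
    · rw [if_neg hxA]
  have hu' : ∀ x ∈ A, (if x ∈ A then u x else v x) = u x := fun x hx => if_pos hx
  exact ⟨⟨_, continuous_of_continuousOn_cover hA hB hAB (hu.congr hu') (hv.congr hv')⟩, hu', hv'⟩

variable (hA : IsOpen A) (hB : IsOpen B) (hAB : A ∪ B = univ)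
    (ρ : C(W, ℝ)) (h0 : ∀ x ∉ B, ρ =ᶠ[𝓝 x] 0) (h1 : ∀ x ∉ A, ρ =ᶠ[𝓝 x] 1)

lemma continuousOn_left (hA : IsOpen A) (hB : IsOpen B) (h0 : ∀ x ∉ B, ρ =ᶠ[𝓝 x] 0)
    (n : LocallyConstant (A ∩ B : Set W) ℤ) :
    ContinuousOn (fun x => ρ x * extendByZero n x) A :=
  continuousOn_mul_extendByZero (hA.inter hB) n ρ.continuous
    fun x hx hx' => h0 x fun h => hx' ⟨hx, h⟩

lemma continuousOn_right (hA : IsOpen A) (hB : IsOpen B) (h1 : ∀ x ∉ A, ρ =ᶠ[𝓝 x] 1)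
    (n : LocallyConstant (A ∩ B : Set W) ℤ) :
    ContinuousOn (fun x => (ρ x - 1) * extendByZero n x) B :=
  continuousOn_mul_extendByZero (hA.inter hB) n (r := fun x => ρ x - 1) (by fun_prop)
    fun x hx hx' => by
      filter_upwards [h1 x fun h => hx' ⟨h, hx⟩] with y hy
      simp [hy]

lemma coe_connectingMap_right (n : LocallyConstant (A ∩ B : Set W) ℤ) (x : W) :
    (((ρ x - 1) * extendByZero n x : ℝ) : UnitAddCircle) =
      connectingMap hA hB hAB ρ h0 h1 n x := by
  change _ = ((ρ x * extendByZero n x : ℝ) : UnitAddCircle)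
  rw [sub_one_mul, AddCircle.coe_sub, coe_extendByZero, sub_zero]

lemma connectingHom_eq_zero_iff (n : LocallyConstant (A ∩ B : Set W) ℤ) :
    connectingHom hA hB hAB ρ h0 h1 n = 0 ↔ connectingMap hA hB hAB ρ h0 h1 n ∈ liftableMaps W :=
  QuotientAddGroup.eq_zero_iff _

/-- Exactness of the Mayer-Vietoris sequence at the zeroth cohomology of `A ∩ B`. -/
lemma ker_connectingHom :
    LinearMap.ker (connectingHom hA hB hAB ρ h0 h1) =
      LinearMap.range (restrictionDifference A B) := by
  ext n
  rw [LinearMap.mem_ker, connectingHom_eq_zero_iff, LinearMap.mem_range]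
  constructor
  · rintro ⟨h, hh⟩
    obtain ⟨a, ha⟩ := exists_locallyConstant_of_continuousOn
      ((continuousOn_left ρ hA hB h0 n).sub h.continuous.continuousOn)
      fun x _ => exists_sub_eq_intCast (hh x).symm
    obtain ⟨b, hb⟩ := exists_locallyConstant_of_continuousOn
      ((continuousOn_right ρ hA hB h1 n).sub h.continuous.continuousOn)
      fun x _ => exists_sub_eq_intCast
        ((coe_connectingMap_right hA hB hAB ρ h0 h1 n x).trans (hh x).symm)
    refine ⟨(a, b), ?_⟩
    ext x
    rw [restrictionDifference_apply, ← @Int.cast_inj ℝ, Int.cast_sub, ha, hb]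
    have hx : extendByZero n x = n x := extendByZero_of_mem n x.2
    simp only [Pi.sub_apply]
    linarith
  · rintro ⟨⟨a, b⟩, rfl⟩
    set n := restrictionDifference A B (a, b) with hn
    obtain ⟨h, hhA, hhB⟩ := exists_glue hA hB hAB
      ((continuousOn_left ρ hA hB h0 n).sub (continuousOn_extendByZero hA a))
      ((continuousOn_right ρ hA hB h1 n).sub (continuousOn_extendByZero hB b)) fun x hxA hxB => by
        have : extendByZero n x = extendByZero a x - extendByZero b x := by
          rw [extendByZero_of_mem n ⟨hxA, hxB⟩, extendByZero_of_mem a hxA,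
            extendByZero_of_mem b hxB, hn, restrictionDifference_apply, Int.cast_sub]
        simp only [Pi.sub_apply]
        linarith
    refine ⟨h, fun x => ?_⟩
    rcases (hAB ▸ mem_univ x : x ∈ A ∪ B) with hx | hx
    · rw [hhA x hx, Pi.sub_apply, AddCircle.coe_sub, coe_extendByZero, sub_zero]
      rfl
    · rw [hhB x hx, Pi.sub_apply, AddCircle.coe_sub, coe_extendByZero, sub_zero,
        coe_connectingMap_right]

/-- Exactness at the first cohomology of the union, when `A` and `B` have none. Given lifts `u` and
`v` of a map to the circle over `A` and over `B`, a preimage of its class is `u - v`. -/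
lemma connectingHom_surjective (hlA : LiftsOn A) (hlB : LiftsOn B) :
    Function.Surjective (connectingHom hA hB hAB ρ h0 h1) := by
  intro g
  obtain ⟨g, rfl⟩ := QuotientAddGroup.mk_surjective g
  obtain ⟨u, hu, hug⟩ := hlA g
  obtain ⟨v, hv, hvg⟩ := hlB g
  obtain ⟨n, hn⟩ := exists_locallyConstant_of_continuousOn (A := A ∩ B)
    ((hu.mono inter_subset_left).sub (hv.mono inter_subset_right))
    fun x hx => exists_sub_eq_intCast ((hug x hx.1).trans (hvg x hx.2).symm)
  obtain ⟨h, hhA, hhB⟩ := exists_glue hA hB hAB (hu.sub (continuousOn_left ρ hA hB h0 n))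
    (hv.sub (continuousOn_right ρ hA hB h1 n)) fun x hxA hxB => by
      have : extendByZero n x = u x - v x := by
        rw [extendByZero_of_mem n ⟨hxA, hxB⟩, hn]
        rfl
      simp only [Pi.sub_apply]
      linarith
  refine ⟨n, ?_⟩
  change ((connectingMap hA hB hAB ρ h0 h1 n : C(W, UnitAddCircle)) : FirstCohomology W) = g
  rw [QuotientAddGroup.eq]
  refine ⟨h, fun x => ?_⟩
  change _ = -connectingMap hA hB hAB ρ h0 h1 n x + g x
  rcases (hAB ▸ mem_univ x : x ∈ A ∪ B) with hx | hx
  · rw [hhA x hx, Pi.sub_apply, AddCircle.coe_sub, hug x hx, sub_eq_neg_add]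
    rfl
  · rw [hhB x hx, Pi.sub_apply, AddCircle.coe_sub, hvg x hx, coe_connectingMap_right,
      sub_eq_neg_add]

/-- The kernel of the difference of restrictions: compatible functions glue to a locally constant
function on a connected space. -/
lemma exists_eq_of_restrictionDifference_eq_zero [PreconnectedSpace W] (hA : IsOpen A)
    (hB : IsOpen B) (hAB : A ∪ B = univ) {a : LocallyConstant A ℤ} {b : LocallyConstant B ℤ}
    (h : restrictionDifference A B (a, b) = 0) :
    ∃ m : ℤ, (∀ x, a x = m) ∧ ∀ x, b x = m := by
  obtain ⟨s, hsA, hsB⟩ := exists_glue hA hB hAB (u := extendByZero a) (v := extendByZero b)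
    (continuousOn_extendByZero hA a) (continuousOn_extendByZero hB b) fun x hxA hxB => by
      have := DFunLike.congr_fun h ⟨x, hxA, hxB⟩
      rw [restrictionDifference_apply, LocallyConstant.coe_zero, Pi.zero_apply, sub_eq_zero] at this
      rw [extendByZero_of_mem a hxA, extendByZero_of_mem b hxB, this]
  obtain ⟨n, hn⟩ := exists_locallyConstant_of_continuousOn (A := univ) s.continuous.continuousOn
    fun x _ => by
      rcases (hAB ▸ mem_univ x : x ∈ A ∪ B) with hx | hx
      · exact ⟨a ⟨x, hx⟩, by rw [hsA x hx, extendByZero_of_mem a hx]⟩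
      · exact ⟨b ⟨x, hx⟩, by rw [hsB x hx, extendByZero_of_mem b hx]⟩
  rcases isEmpty_or_nonempty W with hW | ⟨⟨x₀⟩⟩
  · exact ⟨0, fun x => (hW.false x.1).elim, fun x => (hW.false x.1).elim⟩
  · have : PreconnectedSpace (univ : Set W) := Subtype.preconnectedSpace isPreconnected_univ
    have hn' : ∀ x, s x = n ⟨x₀, mem_univ _⟩ := fun x => (hn ⟨x, mem_univ _⟩).symm.trans <|
      congrArg Int.cast (n.isLocallyConstant.apply_eq_of_preconnectedSpace _ _)
    refine ⟨n ⟨x₀, mem_univ _⟩, fun x => ?_, fun x => ?_⟩ <;> rw [← @Int.cast_inj ℝ, ← hn' x]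
    · rw [hsA x x.2, extendByZero_of_mem a x.2]
    · rw [hsB x x.2, extendByZero_of_mem b x.2]

end MayerVietoris

/-- The rank of the first cohomology of a connected space covered by two open sets without first
cohomology, in terms of the numbers of pieces of these sets and of their intersection. -/
theorem finrank_firstCohomology {W : Type*} [TopologicalSpace W] [NormalSpace W]
    [ConnectedSpace W] {A B : Set W} (hA : IsOpen A) (hB : IsOpen B) (hAB : A ∪ B = univ)
    (hlA : LiftsOn A) (hlB : LiftsOn B) {ι ι' κ : Type*} [Finite ι] [Finite ι'] [Finite κ]
    (hι : HasPieces A ι) (hι' : HasPieces B ι') (hκ : HasPieces (A ∩ B : Set W) κ) :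
    Module.finrank ℤ (FirstCohomology W) + (Nat.card ι + Nat.card ι') = Nat.card κ + 1 := by
  obtain ⟨ρ, h0, h1⟩ := exists_cutoff hA hB hAB
  obtain ⟨eA⟩ := hι.nonempty_linearEquiv
  obtain ⟨eB⟩ := hι'.nonempty_linearEquiv
  obtain ⟨eAB⟩ := hκ.nonempty_linearEquiv
  cases nonempty_fintype ι
  cases nonempty_fintype ι'
  cases nonempty_fintype κ
  have := Module.Finite.equiv eA
  have := Module.Free.of_equiv eA
  have := Module.Finite.equiv eB
  have := Module.Free.of_equiv eB
  have := Module.Finite.equiv eAB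
  have hrA : Module.finrank ℤ (LocallyConstant A ℤ) = Nat.card ι := by
    rw [← eA.finrank_eq, Module.finrank_fintype_fun_eq_card, Nat.card_eq_fintype_card]
  have hrB : Module.finrank ℤ (LocallyConstant B ℤ) = Nat.card ι' := by
    rw [← eB.finrank_eq, Module.finrank_fintype_fun_eq_card, Nat.card_eq_fintype_card]
  have hrAB : Module.finrank ℤ (LocallyConstant (A ∩ B : Set W) ℤ) = Nat.card κ := by
    rw [← eAB.finrank_eq, Module.finrank_fintype_fun_eq_card, Nat.card_eq_fintype_card]
  set φ := restrictionDifference A B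
  set δ := connectingHom hA hB hAB ρ h0 h1
  -- The kernel of `φ` consists of the constants.
  have hker : Module.finrank ℤ (LinearMap.ker φ) = 1 := by
    let c : ℤ →ₗ[ℤ] LocallyConstant A ℤ × LocallyConstant B ℤ :=
      (LocallyConstant.constₗ ℤ).prod (LocallyConstant.constₗ ℤ)
    have hrange : LinearMap.ker φ = LinearMap.range c := by
      ext ⟨a, b⟩
      constructor
      · intro h
        obtain ⟨m, hma, hmb⟩ := exists_eq_of_restrictionDifference_eq_zero hA hB hAB h
        exact ⟨m, Prod.ext (LocallyConstant.ext fun x => (hma x).symm)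
          (LocallyConstant.ext fun x => (hmb x).symm)⟩
      · rintro ⟨m, hm⟩
        rw [← hm]
        exact LocallyConstant.ext fun x => sub_self m
    rw [hrange, LinearMap.finrank_range_of_inj, Module.finrank_self]
    intro m m' h
    obtain ⟨x⟩ := ‹ConnectedSpace W›.toNonempty
    rcases (hAB ▸ mem_univ x : x ∈ A ∪ B) with hx | hx
    · exact DFunLike.congr_fun (congrArg Prod.fst h) ⟨x, hx⟩
    · exact DFunLike.congr_fun (congrArg Prod.snd h) ⟨x, hx⟩
  have e1 := (LinearMap.ker φ).finrank_quotient_add_finrank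
  have e2 := (LinearMap.ker δ).finrank_quotient_add_finrank
  rw [φ.quotKerEquivRange.finrank_eq, hker, Module.finrank_prod, hrA, hrB] at e1
  rw [(δ.quotKerEquivOfSurjective
    (connectingHom_surjective hA hB hAB ρ h0 h1 hlA hlB)).finrank_eq, ker_connectingHom, hrAB] at e2
  change _ + Module.finrank ℤ (LinearMap.range φ) = _ at e2
  omega

/-! ### Slit planes and strips -/

section Slits

/-- The plane slit along the closed vertical rays which start at the points of `P` and go down if
`s = 1`, respectively up if `s = -1`. -/
def slitAlong (s : ℝ) (P : Finset ℂ) : Set ℂ :=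
  {z | ∀ a ∈ P, z.re = a.re → 0 < s * (z.im - a.im)}

/-- The complement of the vertical lines with abscissae in `R`. -/
def verticalStrips (R : Finset ℝ) : Set ℂ := {z | z.re ∉ R}

variable {s : ℝ} {P : Finset ℂ}

lemma isOpen_slitAlong (s : ℝ) (P : Finset ℂ) : IsOpen (slitAlong s P) := by
  have : slitAlong s P = ⋂ a ∈ P, ({z | z.re ≠ a.re} ∪ {z | 0 < s * (z.im - a.im)}) := by
    ext z
    simp [slitAlong, imp_iff_not_or]
  rw [this]
  refine isOpen_biInter_finset fun a _ => IsOpen.union ?_ ?_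
  · exact isOpen_ne_fun Complex.continuous_re continuous_const
  · exact isOpen_lt continuous_const (by fun_prop)

lemma slitAlong_subset_compl : slitAlong s P ⊆ (P : Set ℂ)ᶜ := fun z hz hzP => by
  simpa using hz z hzP rfl

/-- As no two punctures are on the same vertical line, the removed rays of the two slit planes meet
in the punctures only. -/
lemma slitAlong_union (hP : InjOn Complex.re P) :
    slitAlong 1 P ∪ slitAlong (-1) P = (P : Set ℂ)ᶜ := by
  refine (union_subset slitAlong_subset_compl slitAlong_subset_compl).antisymm fun z hz => ?_
  by_contra hcon
  obtain ⟨h1, h2⟩ := not_or.mp hcon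
  simp only [slitAlong, mem_ofPred_eq, not_forall] at h1 h2
  obtain ⟨a, ha, hza, h1⟩ := h1
  obtain ⟨b, hb, hzb, h2⟩ := h2
  obtain rfl := hP ha hb (hza.symm.trans hzb)
  have : z = a := Complex.ext hza (by linarith)
  exact hz (this ▸ ha)

lemma slitAlong_inter :
    slitAlong 1 P ∩ slitAlong (-1) P = verticalStrips (P.image Complex.re) := by
  ext z
  simp only [slitAlong, verticalStrips, mem_inter_iff, mem_ofPred_eq, Finset.mem_image, not_exists,
    not_and]
  constructor
  · rintro ⟨h1, h2⟩ a ha hza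
    linarith [h1 a ha hza.symm, h2 a ha hza.symm]
  · exact fun h => ⟨fun a ha hza => absurd hza.symm (h a ha),
      fun a ha hza => absurd hza.symm (h a ha)⟩

/-- A slit plane is deformed along the vertical direction into a half-plane, which is convex. -/
lemma contractibleSpace_slitAlong (hs : s * s = 1) (P : Finset ℂ) :
    ContractibleSpace (slitAlong s P) := by
  set M : ℝ := 1 + ∑ a ∈ P, |a.im|
  have hM : ∀ a ∈ P, |a.im| < M := fun a ha => by
    have := Finset.single_le_sum (f := fun a : ℂ => |a.im|) (fun _ _ => abs_nonneg _) ha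
    simp only [M]
    linarith
  have habs : |s| = 1 := by
    rcases mul_self_eq_one_iff.mp hs with rfl | rfl <;> simp
  have hsle : ∀ x : ℝ, -|x| ≤ s * x := fun x => by
    have := neg_abs_le (s * x)
    rwa [abs_mul, habs, one_mul] at this
  have hM0 : 0 < M := by
    have : 0 ≤ ∑ a ∈ P, |a.im| := Finset.sum_nonneg fun _ _ => abs_nonneg _
    simp only [M]
    linarith
  -- Push upwards (for `s = 1`) by a distance which moves every point above all punctures.
  have hpush : ∀ (t : unitInterval) (z : slitAlong s P),
      (⟨(z : ℂ).re, (z : ℂ).im + t * (s * (|(z : ℂ).im| + M))⟩ : ℂ) ∈ slitAlong s P := by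
    intro t z a ha hza
    have h1 := z.2 a ha hza
    have h2 : 0 ≤ (t : ℝ) * (|(z : ℂ).im| + M) := mul_nonneg t.2.1 (by positivity)
    calc 0 < s * ((z : ℂ).im - a.im) + t * (|(z : ℂ).im| + M) := by linarith
      _ = s * ((z : ℂ).im - a.im) + (s * s) * (t * (|(z : ℂ).im| + M)) := by rw [hs, one_mul]
      _ = _ := by ring
  -- Contract the image, inside a half-plane, to the point `s * M * I`.
  have hline : ∀ (t : unitInterval) (z : slitAlong s P),
      (⟨(1 - t) * (z : ℂ).re,
        (1 - t) * ((z : ℂ).im + s * (|(z : ℂ).im| + M)) + t * (s * M)⟩ : ℂ) ∈ slitAlong s P := by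
    intro t z a ha _
    have h1 : 0 < s * ((z : ℂ).im + s * (|(z : ℂ).im| + M) - a.im) := by
      have e : s * ((z : ℂ).im + s * (|(z : ℂ).im| + M) - a.im) =
        s * (z : ℂ).im + (s * s) * (|(z : ℂ).im| + M) + s * (-a.im) := by ring
      rw [e, hs]
      have := hsle (z : ℂ).im
      have := hsle (-a.im)
      rw [abs_neg] at this
      linarith [hM a ha]
    have h2 : 0 < s * (s * M - a.im) := by
      have e : s * (s * M - a.im) = (s * s) * M + s * (-a.im) := by ring
      rw [e, hs]
      have := hsle (-a.im)
      rw [abs_neg] at this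
      linarith [hM a ha]
    have e : s * ((1 - t) * ((z : ℂ).im + s * (|(z : ℂ).im| + M)) + t * (s * M) - a.im) =
        (1 - t) * (s * ((z : ℂ).im + s * (|(z : ℂ).im| + M) - a.im)) +
          t * (s * (s * M - a.im)) := by ring
    change 0 < s * ((1 - t) * ((z : ℂ).im + s * (|(z : ℂ).im| + M)) + t * (s * M) - a.im)
    rw [e]
    rcases eq_or_lt_of_le t.2.1 with ht | ht
    · rw [← ht]
      linarith
    · have := mul_nonneg (sub_nonneg.mpr t.2.2) h1.le
      have := mul_pos ht h2
      linarith
  have hmk : ∀ {Y : Type} [TopologicalSpace Y] {u v : Y → ℝ}, Continuous u → Continuous v →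
      Continuous fun y => (⟨u y, v y⟩ : ℂ) := fun hu hv =>
    Complex.equivRealProdCLM.symm.continuous.comp (hu.prodMk hv)
  have hcont_im : Continuous fun y : unitInterval × slitAlong s P => (y.2 : ℂ).im := by fun_prop
  have hcont_re : Continuous fun y : unitInterval × slitAlong s P => (y.2 : ℂ).re := by fun_prop
  have hcont_t : Continuous fun y : unitInterval × slitAlong s P => (y.1 : ℝ) := by fun_prop
  rw [contractible_iff_id_nullhomotopic]
  refine ⟨⟨⟨0, s * M⟩, fun a ha _ => ?_⟩, ?_⟩
  · have e : s * (s * M - a.im) = (s * s) * M + s * (-a.im) := by ring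
    change 0 < s * (s * M - a.im)
    rw [e, hs]
    have := hsle (-a.im)
    rw [abs_neg] at this
    linarith [hM a ha]
  let F : C(unitInterval × slitAlong s P, slitAlong s P) :=
    ⟨fun y => ⟨_, hpush y.1 y.2⟩, (hmk hcont_re (by fun_prop)).subtype_mk _⟩
  let G : C(unitInterval × slitAlong s P, slitAlong s P) :=
    ⟨fun y => ⟨_, hline y.1 y.2⟩, (hmk (by fun_prop) (by fun_prop)).subtype_mk _⟩
  let k : C(slitAlong s P, slitAlong s P) :=
    ⟨fun z => F (1, z), by fun_prop⟩
  refine ContinuousMap.Homotopic.trans (g := k) ⟨⟨F, fun z => ?_, fun z => rfl⟩⟩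
    ⟨⟨G, fun z => ?_, fun z => ?_⟩⟩
  · exact Subtype.ext (Complex.ext rfl (by simp [F]))
  · exact Subtype.ext (Complex.ext (by simp [G, k, F]) (by simp [G, k, F]))
  · exact Subtype.ext (Complex.ext (by simp [G]) (by simp [G]))

/-- Any number of elements of `R` lie below a suitable real number outside `R`. -/
lemma exists_card_filter_lt (R : Finset ℝ) (i : Fin (R.card + 1)) :
    ∃ t ∉ R, (R.filter (· < t)).card = i := by
  have hnear : ∀ r : ℝ, ∃ t ∉ R, ∀ a ∈ R, a < t ↔ a ≤ r := fun r => by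
    have : ∀ᶠ t in 𝓝[>] r, r < t ∧ ∀ a ∈ R, r < a → t < a :=
      Filter.Eventually.and self_mem_nhdsWithin <| (R.eventually_all).mpr fun a _ => by
        by_cases h : r < a
        · filter_upwards [nhdsWithin_le_nhds (eventually_lt_nhds h)] with t ht _ using ht
        · exact Filter.Eventually.of_forall fun t ht => absurd ht h
    obtain ⟨t, hrt, ht⟩ := this.exists
    refine ⟨t, fun htR => (ht t htR hrt).false, fun a ha => ⟨fun hat => ?_, fun har => ?_⟩⟩
    · by_contra h
      exact (hat.trans (ht a ha (not_le.mp h))).false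
    · exact har.trans_lt hrt
  induction i using Fin.cases with
  | zero =>
    obtain ⟨m, hm⟩ := R.finite_toSet.bddBelow
    obtain ⟨t, htR, ht⟩ := hnear (m - 1)
    refine ⟨t, htR, ?_⟩
    rw [Fin.val_zero, Finset.card_eq_zero, Finset.filter_eq_empty_iff]
    intro a ha hat
    linarith [hm ha, (ht a ha).mp hat]
  | succ k =>
    obtain ⟨t, htR, ht⟩ := hnear (R.orderEmbOfFin rfl k)
    refine ⟨t, htR, ?_⟩
    have : R.filter (· < t) = (Finset.Iic k).map (R.orderEmbOfFin rfl).toEmbedding := by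
      ext a
      simp only [Finset.mem_filter, Finset.mem_map, Finset.mem_Iic]
      constructor
      · rintro ⟨ha, hat⟩
        have : a ∈ Set.range (R.orderEmbOfFin rfl) := by
          rwa [Finset.range_orderEmbOfFin]
        obtain ⟨j, rfl⟩ := this
        exact ⟨j, by simpa using (ht _ ha).mp hat, rfl⟩
      · rintro ⟨j, hj, rfl⟩
        have hmem : R.orderEmbOfFin rfl j ∈ R := R.orderEmbOfFin_mem rfl j
        exact ⟨hmem, (ht _ hmem).mpr (by simpa using hj)⟩
    rw [this, Finset.card_map, Fin.card_Iic, Fin.val_succ]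

/-- The strip containing `z` is determined by the number of lines to the left of `z`. -/
lemma hasPieces_verticalStrips (R : Finset ℝ) :
    HasPieces (verticalStrips R) (Fin (R.card + 1)) := by
  classical
  refine ⟨fun z => ⟨(R.filter (· < (z : ℂ).re)).card,
    Nat.lt_succ_of_le (Finset.card_filter_le _ _)⟩, ?_, fun i => ?_⟩
  · rw [IsLocallyConstant.iff_eventually_eq]
    intro z
    have : ∀ᶠ z' : verticalStrips R in 𝓝 z, ∀ a ∈ R, a < (z' : ℂ).re ↔ a < (z : ℂ).re := by
      refine (R.eventually_all).mpr fun a ha => ?_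
      have hc : ContinuousAt (fun z' : verticalStrips R => (z' : ℂ).re) z := by fun_prop
      have hne : (z : ℂ).re ≠ a := fun h => z.2 (by rwa [h])
      rcases lt_or_gt_of_ne hne with h | h
      · filter_upwards [hc.eventually_lt continuousAt_const h] with z' hz'
        exact iff_of_false hz'.not_gt h.not_gt
      · filter_upwards [continuousAt_const.eventually_lt hc h] with z' hz'
        exact iff_of_true hz' h
    filter_upwards [this] with z' hz'
    rw [Fin.mk.injEq, Finset.filter_congr hz']
  · obtain ⟨t, htR, ht⟩ := exists_card_filter_lt R i
    refine ⟨⟨⟨(t : ℂ), by simpa [verticalStrips] using htR⟩, Fin.ext (by simpa using ht)⟩, ?_⟩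
    rw [← IsInducing.subtypeVal.isPreconnected_image]
    suffices Convex ℝ (Complex.re ⁻¹' {x | x ∉ R ∧ (R.filter (· < x)).card = i}) by
      convert! this.isPreconnected using 1
      ext z
      constructor
      · rintro ⟨z, hz, rfl⟩
        exact ⟨z.2, congrArg Fin.val hz⟩
      · rintro ⟨hzR, hz⟩
        exact ⟨⟨z, hzR⟩, Fin.ext hz, rfl⟩
    refine (OrdConnected.convex ⟨?_⟩).is_linear_preimage Complex.reLm.isLinear
    rintro x ⟨hxR, hx⟩ y ⟨hyR, hy⟩ z ⟨hxz, hzy⟩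
    have hsub : ∀ {u v : ℝ}, u ≤ v → R.filter (· < u) ⊆ R.filter (· < v) := fun huv a ha => by
      rw [Finset.mem_filter] at ha ⊢
      exact ⟨ha.1, ha.2.trans_le huv⟩
    -- Between `x` and `y` there is no point of `R`.
    have hxy : R.filter (· < x) = R.filter (· < y) :=
      Finset.eq_of_subset_of_card_le (hsub (hxz.trans hzy)) (hy.trans hx.symm).le
    have hxz' : R.filter (· < z) = R.filter (· < x) :=
      (hxy ▸ hsub hzy).antisymm (hsub hxz)
    refine ⟨fun hzR => ?_, hxz' ▸ hx⟩
    have : z ∈ R.filter (· < x) := by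
      rw [hxy, Finset.mem_filter]
      exact ⟨hzR, lt_of_le_of_ne hzy fun h => hyR (h ▸ hzR)⟩
    exact ((Finset.mem_filter.mp this).2.trans_le hxz).false

end Slits

/-! ### Coverings of punctured planes -/

section Sheets

variable {W X : Type*} [TopologicalSpace W] [TopologicalSpace X] {p : W → X} {U D : Set X}

/-- Over a simply connected subset, a covering map is trivial: `s e` is the section through the
point `e` of the fiber over `z₀`, and `c x` is the sheet which contains `x`. -/
lemma IsCoveringMapOn.exists_sections (hp : IsCoveringMapOn p U) (hDU : D ⊆ U)
    [SimplyConnectedSpace D] [LocallyPathConnectedSpace D] (z₀ : D) :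
    ∃ (s : p ⁻¹' {z₀.1} → C(D, W)) (c : p ⁻¹' D → p ⁻¹' {z₀.1}),
      (∀ e z, p (s e z) = z) ∧ (∀ x, s (c x) ⟨p x, x.2⟩ = x) ∧
      (∀ e z (h : s e z ∈ p ⁻¹' D), c ⟨s e z, h⟩ = e) ∧ IsLocallyConstant c := by
  have hlift : ∀ (z : D) (x : W), p x = z →
      ∃! F : C(D, W), F z = x ∧ p ∘ F = (Subtype.val : D → X) := fun z x hx =>
    hp.existsUnique_continuousMap_lifts ⟨Subtype.val, continuous_subtype_val⟩ hx
      fun a => hDU a.2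
  choose s hs hsu using fun e : p ⁻¹' {z₀.1} => hlift z₀ e e.2
  choose r hr hru using fun x : p ⁻¹' D => hlift ⟨p x, x.2⟩ x rfl
  have hps : ∀ e z, p (s e z) = z := fun e z => congrFun (hs e).2 z
  let c : p ⁻¹' D → p ⁻¹' {z₀.1} := fun x => ⟨r x z₀, congrFun (hr x).2 z₀⟩
  have hsc : ∀ x, s (c x) = r x := fun x => (hsu (c x) (r x) ⟨rfl, (hr x).2⟩).symm
  have hcs : ∀ e z (h : s e z ∈ p ⁻¹' D), c ⟨s e z, h⟩ = e := fun e z h => by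
    have : s e = r ⟨s e z, h⟩ := hru ⟨s e z, h⟩ (s e)
      ⟨congrArg (s e) (Subtype.ext (hps e z)), (hs e).2⟩
    apply Subtype.ext
    change r ⟨s e z, h⟩ z₀ = e
    rw [← this, (hs e).1]
  have hsx : ∀ x, s (c x) ⟨p x, x.2⟩ = x := fun x => by rw [hsc, (hr x).1]
  refine ⟨s, c, hps, hsx, hcs, ?_⟩
  rw [IsLocallyConstant.iff_eventually_eq]
  intro x
  obtain ⟨φ, hxφ, hφ⟩ := hp.isLocalHomeomorphOn x (hDU x.2)
  have hpc : ContinuousOn p (p ⁻¹' D) := hp.continuousOn.mono (preimage_mono hDU)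
  have hcont : Continuous fun x' : p ⁻¹' D => s (c x) ⟨p x', x'.2⟩ :=
    (s (c x)).continuous.comp (hpc.domRestrict.subtype_mk _)
  have h1 : ∀ᶠ x' : p ⁻¹' D in 𝓝 x, s (c x) ⟨p x', x'.2⟩ ∈ φ.source :=
    hcont.continuousAt.eventually_mem (φ.open_source.mem_nhds ((hsx x).symm ▸ hxφ))
  have h2 : ∀ᶠ x' : p ⁻¹' D in 𝓝 x, (x' : W) ∈ φ.source :=
    continuous_subtype_val.continuousAt.eventually_mem (φ.open_source.mem_nhds hxφ)
  filter_upwards [h1, h2] with x' hx1 hx2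
  -- Close to `x`, the point `x'` and the point of the sheet of `x` over `p x'` are equal.
  have heq : s (c x) ⟨p x', x'.2⟩ = x' := φ.injOn hx1 hx2 <| by
    rw [← hφ, hps]
  have := hcs (c x) ⟨p x', x'.2⟩ (by rw [heq]; exact x'.2)
  rw [← this]
  exact congrArg c (Subtype.ext heq.symm)

/-- On each sheet over a simply connected set, maps to the circle lift through `ℝ → ℝ / ℤ`. -/
lemma LiftsOn.of_isCoveringMapOn (hp : IsCoveringMapOn p U) (hDU : D ⊆ U)
    [SimplyConnectedSpace D] [LocallyPathConnectedSpace D] (z₀ : D) : LiftsOn (p ⁻¹' D) := by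
  classical
  intro g
  obtain ⟨s, c, hps, hsx, hcs, hc⟩ := hp.exists_sections hDU z₀
  have hlift : ∀ e, ∃ h : C(D, ℝ), ∀ z, (h z : UnitAddCircle) = g (s e z) := fun e => by
    obtain ⟨r₀, hr₀⟩ := QuotientAddGroup.mk_surjective (g (s e z₀))
    obtain ⟨h, hh, -⟩ := (AddCircle.isCoveringMap_coe (1 : ℝ)).existsUnique_continuousMap_lifts
      (g.comp (s e)) z₀ r₀ hr₀
    exact ⟨h, congrFun hh.2⟩
  choose h hh using hlift
  refine ⟨fun x => if hx : x ∈ p ⁻¹' D then h (c ⟨x, hx⟩) ⟨p x, hx⟩ else 0, ?_, fun x hx => ?_⟩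
  · rw [continuousOn_iff_continuous_domRestrict, continuous_iff_continuousAt]
    intro x
    have hpc : ContinuousOn p (p ⁻¹' D) := hp.continuousOn.mono (preimage_mono hDU)
    have hcont : Continuous fun x' : p ⁻¹' D => h (c x) ⟨p x', x'.2⟩ :=
      (h (c x)).continuous.comp (hpc.domRestrict.subtype_mk _)
    refine hcont.continuousAt.congr ?_
    filter_upwards [IsLocallyConstant.iff_eventually_eq c |>.mp hc x] with x' hx'
    rw [← hx']
    rw [domRestrict_apply, dif_pos x'.2]
  · beta_reduce
    rw [dif_pos hx, hh, hsx]

/-- Over a subset `E` of a simply connected set, there is one copy of each piece of `E` in every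
sheet. -/
lemma HasPieces.preimage (hp : IsCoveringMapOn p U) (hDU : D ⊆ U)
    [SimplyConnectedSpace D] [LocallyPathConnectedSpace D] (z₀ : D) {E : Set X} (hE : E ⊆ D)
    {κ : Type*} (hκ : HasPieces E κ) : HasPieces (p ⁻¹' E) (p ⁻¹' {z₀.1} × κ) := by
  obtain ⟨s, c, hps, hsx, hcs, hc⟩ := hp.exists_sections hDU z₀
  obtain ⟨k, hk, hkc⟩ := hκ
  have hpc : ContinuousOn p (p ⁻¹' E) := hp.continuousOn.mono (preimage_mono (hE.trans hDU))
  have hc' := hc.comp_continuous (continuous_inclusion (preimage_mono (f := p) hE))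
  have hk' := hk.comp_continuous (f := fun x : p ⁻¹' E => (⟨p x, x.2⟩ : E))
    (hpc.domRestrict.subtype_mk _)
  refine ⟨fun x => (c (inclusion (preimage_mono hE) x), k ⟨p x, x.2⟩), hc'.prodMk hk', ?_⟩
  rintro ⟨e, j⟩
  let σ : E → p ⁻¹' E := fun z => ⟨s e (inclusion hE z), by
    rw [mem_preimage, hps]
    exact z.2⟩
  have hσ : Continuous σ :=
    ((s e).continuous.comp (continuous_inclusion hE)).subtype_mk _
  have hpσ : ∀ z, (⟨p (σ z), (σ z).2⟩ : E) = z := fun z => Subtype.ext (hps e (inclusion hE z))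
  have himage : (fun x : p ⁻¹' E => (c (inclusion (preimage_mono hE) x), k ⟨p x, x.2⟩)) ⁻¹'
      {(e, j)} = σ '' (k ⁻¹' {j}) := by
    ext x
    constructor
    · intro hx
      obtain ⟨hx1, hx2⟩ := Prod.ext_iff.mp (show (_, _) = (e, j) from hx)
      refine ⟨⟨p x, x.2⟩, hx2, Subtype.ext ?_⟩
      have := hsx (inclusion (preimage_mono hE) x)
      rw [show c (inclusion (preimage_mono hE) x) = e from hx1] at this
      exact this
    · rintro ⟨z, hz, rfl⟩
      exact Prod.ext (hcs e (inclusion hE z) _) ((congrArg k (hpσ z)).trans hz)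
  rw [himage]
  exact (hkc j).image σ hσ.continuousOn

end Sheets

section PlanarCoverings

lemma isCoveringMap_self {X : Type*} [TopologicalSpace X] : IsCoveringMap (fun x : X => x) :=
  fun x => IsEvenlyCovered.to_isEvenlyCovered_preimage (I := Unit) ⟨inferInstance, univ, mem_univ x,
    isOpen_univ, isOpen_univ, (Homeomorph.prodPUnit _).symm, fun _ => rfl⟩

lemma HasPieces.of_connectedSpace (X : Type*) [TopologicalSpace X] [ConnectedSpace X] :
    HasPieces X Unit :=
  ⟨fun _ => (), IsLocallyConstant.const _, fun i => by
    simpa using isConnected_univ (α := X)⟩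

/-- A generic rotation and dilation separates the real parts of finitely many points. -/
lemma exists_ne_zero_injOn_re_mul (P : Finset ℂ) :
    ∃ u : ℂ, u ≠ 0 ∧ InjOn (fun z => (z * u).re) P := by
  let f : ({v : P × P // v.1 ≠ v.2} ⊕ Unit) → Module.Dual ℝ ℂ := Sum.elim
    (fun v => Complex.reLm ∘ₗ LinearMap.mulLeft ℝ ((v.1.1 : ℂ) - v.1.2)) fun _ => Complex.reLm
  obtain ⟨u, hu⟩ := Module.Dual.exists_forall_ne_zero_of_forall_exists f (by
    rintro (v | _)
    · have hv : (v.1.1 : ℂ) - v.1.2 ≠ 0 := sub_ne_zero.mpr fun h => v.2 (Subtype.ext h)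
      exact ⟨((v.1.1 : ℂ) - v.1.2)⁻¹, by simp [f, mul_inv_cancel₀ hv]⟩
    · exact ⟨1, by simp [f]⟩)
  refine ⟨u, fun h0 => hu (Sum.inr ()) (by simp [f, h0]), fun a ha b hb hab => ?_⟩
  by_contra hne
  refine hu (Sum.inl ⟨(⟨a, ha⟩, ⟨b, hb⟩), fun h => hne (congrArg Subtype.val h)⟩) ?_
  change ((a - b) * u).re = 0
  rw [sub_mul, Complex.sub_re]
  exact sub_eq_zero.mpr hab

variable {W : Type*} [TopologicalSpace W] [NormalSpace W] [ConnectedSpace W] {p : W → ℂ}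
  {P : Finset ℂ} {d : ℕ}

/-- The first Betti number of a `d`-sheeted covering of the plane punctured at the points of `P`:
the plane minus the points of `P` is the union of two slit planes, which meet in `|P| + 1`
strips. -/
lemma finrank_firstCohomology_of_injOn_re (hP : InjOn Complex.re P) (hpP : ∀ x, p x ∉ P)
    (hp : IsCoveringMapOn p (P : Set ℂ)ᶜ) (hd : 0 < d)
    (hcard : ∀ z ∉ P, Nat.card (p ⁻¹' {z}) = d) :
    Module.finrank ℤ (FirstCohomology W) + 2 * d = d * (P.card + 1) + 1 := by
  have hpc : Continuous p := by
    rw [← continuousOn_univ]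
    exact hp.continuousOn.mono fun x _ => hpP x
  have hsub : ∀ s, slitAlong s P ⊆ (P : Set ℂ)ᶜ := fun s => slitAlong_subset_compl
  have := fun s => (isOpen_slitAlong s P).locallyPathConnectedSpace
  have := contractibleSpace_slitAlong (s := 1) (by norm_num) P
  have := contractibleSpace_slitAlong (s := -1) (by norm_num) P
  obtain ⟨z⟩ : Nonempty (slitAlong 1 P) := inferInstance
  obtain ⟨z'⟩ : Nonempty (slitAlong (-1) P) := inferInstance
  have hz := hcard z (hsub _ z.2)
  have hz' := hcard z' (hsub _ z'.2)
  have : Finite (p ⁻¹' {z.1}) := Nat.finite_of_card_ne_zero (by omega)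
  have : Finite (p ⁻¹' {z'.1}) := Nat.finite_of_card_ne_zero (by omega)
  have hstrips : HasPieces (slitAlong 1 P ∩ slitAlong (-1) P : Set ℂ) (Fin (P.card + 1)) := by
    have := hasPieces_verticalStrips (P.image Complex.re)
    rwa [← slitAlong_inter, Finset.card_image_of_injOn hP] at this
  have key := finrank_firstCohomology (W := W)
    ((isOpen_slitAlong 1 P).preimage hpc) ((isOpen_slitAlong (-1) P).preimage hpc)
    (by rw [← preimage_union, slitAlong_union hP]; exact eq_univ_of_forall hpP)
    (LiftsOn.of_isCoveringMapOn hp (hsub _) z) (LiftsOn.of_isCoveringMapOn hp (hsub _) z')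
    (HasPieces.preimage hp (hsub _) z subset_rfl (HasPieces.of_connectedSpace _))
    (HasPieces.preimage hp (hsub _) z' subset_rfl (HasPieces.of_connectedSpace _))
    (HasPieces.preimage hp (hsub _) z inter_subset_left hstrips)
  simp only [Nat.card_prod, hz, hz', Nat.card_eq_fintype_card, Fintype.card_unit,
    Fintype.card_fin] at key
  omega

lemma finrank_firstCohomology_of_isCoveringMapOn (hpP : ∀ x, p x ∉ P)
    (hp : IsCoveringMapOn p (P : Set ℂ)ᶜ) (hd : 0 < d)
    (hcard : ∀ z ∉ P, Nat.card (p ⁻¹' {z}) = d) :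
    Module.finrank ℤ (FirstCohomology W) + 2 * d = d * (P.card + 1) + 1 := by
  obtain ⟨u, hu, hinj⟩ := exists_ne_zero_injOn_re_mul P
  -- Turning the plane makes the real parts of the punctures distinct.
  let L : ℂ ≃ₜ ℂ := Homeomorph.mulRight₀ u hu
  have hL : ∀ z, L z ∈ P.image L ↔ z ∈ P := fun z => L.injective.mem_finset_image
  have hLset : ((P.image L : Finset ℂ) : Set ℂ)ᶜ = L.symm ⁻¹' (P : Set ℂ)ᶜ := by
    ext z
    obtain ⟨z, rfl⟩ := L.surjective z
    simp
  have key := finrank_firstCohomology_of_injOn_re (p := L ∘ p) (P := P.image L) (d := d) ?_ ?_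
    (hLset ▸ hp.homeomorph_comp L) hd ?_
  · rwa [Finset.card_image_of_injective _ L.injective] at key
  · rw [Finset.coe_image]
    exact InjOn.image_of_comp hinj
  · exact fun x => (hL _).not.mpr (hpP x)
  · intro z hz
    obtain ⟨z, rfl⟩ := L.surjective z
    have : L ∘ p ⁻¹' {L z} = p ⁻¹' {z} := by
      ext x
      simp
    rw [this]
    exact hcard z ((hL z).not.mp hz)

end PlanarCoverings

/-- The Riemann-Hurwitz formula for a covering between punctured planes: both sides compute the
first Betti number of the source. -/
theorem IsCoveringMap.card_punctures {P Q : Finset ℂ} {d : ℕ}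
    {p : ((Q : Set ℂ)ᶜ : Set ℂ) → ((P : Set ℂ)ᶜ : Set ℂ)} (hp : IsCoveringMap p) (hd : 0 < d)
    (hcard : ∀ z, Nat.card (p ⁻¹' {z}) = d) : Q.card + 2 * d = d * (P.card + 1) + 1 := by
  have hopen : ∀ R : Finset ℂ, IsOpen (R : Set ℂ)ᶜ := fun R => R.finite_toSet.isClosed.isOpen_compl
  have hconn : ConnectedSpace ((Q : Set ℂ)ᶜ : Set ℂ) := Subtype.connectedSpace <|
    Q.finite_toSet.countable.isConnected_compl_of_one_lt_rank
      (by rw [Complex.rank_real_complex]; norm_num)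
  have h1 := finrank_firstCohomology_of_isCoveringMapOn (p := fun x => (p x : ℂ)) (P := P)
    (fun x => (p x).2) (IsCoveringMapOn.of_isCoveringMap_subtype (hopen P) (fun x => (p x).2) hp)
    hd fun z hz => by
      rw [← hcard ⟨z, hz⟩]
      refine Nat.card_congr (Equiv.setCongr (Set.ext fun x => ?_))
      simp [Subtype.ext_iff]
  -- The same computation for the trivial one-sheeted covering.
  have h2 : Module.finrank ℤ (FirstCohomology ((Q : Set ℂ)ᶜ : Set ℂ)) + 2 * 1 =
      1 * (Q.card + 1) + 1 := finrank_firstCohomology_of_isCoveringMapOn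
    (p := ((↑) : ((Q : Set ℂ)ᶜ : Set ℂ) → ℂ)) (P := Q) (d := 1) (fun x => x.2)
    (IsCoveringMapOn.of_isCoveringMap_subtype (hopen Q) (fun x => x.2)
      isCoveringMap_self) one_pos fun z hz => by
      rw [Nat.card_eq_one_iff_unique]
      exact ⟨⟨fun a b => Subtype.ext (Subtype.ext (a.2.trans b.2.symm))⟩, ⟨⟨⟨z, hz⟩, rfl⟩⟩⟩
  omega

/-! ### Branched coverings of spheres -/

section Spheres

/-- Stereographic projection from a point of `A`. -/
lemma exists_homeomorph_compl_finset {S : Type*} [TopologicalSpace S]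
    (e : S ≃ₜ Metric.sphere (0 : EuclideanSpace ℝ (Fin 3)) 1) {A : Set S} (hA : A.Finite)
    (hA' : A.Nonempty) :
    ∃ Q : Finset ℂ, Q.card + 1 = A.ncard ∧ Nonempty ((Aᶜ : Set S) ≃ₜ ((Q : Set ℂ)ᶜ : Set ℂ)) := by
  obtain ⟨a, ha⟩ := hA'
  have : Fact (Module.finrank ℝ (EuclideanSpace ℝ (Fin 3)) = 2 + 1) := ⟨by simp⟩
  let φ : OpenPartialHomeomorph S ℂ :=
    (e.transOpenPartialHomeomorph (stereographic' 2 (e a))).transHomeomorph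
      Complex.orthonormalBasisOneI.repr.symm.toHomeomorph
  have hsource : φ.source = {a}ᶜ := by
    ext x
    simp [φ]
  have htarget : φ.target = univ := by simp [φ]
  have hAsub : Aᶜ ⊆ φ.source := by
    rw [hsource]
    exact compl_subset_compl.mpr (singleton_subset_iff.mpr ha)
  have hdiff : A \ {a} ⊆ φ.source := hsource ▸ fun x hx => hx.2
  have hfin : (φ '' (A \ {a})).Finite := (hA.subset sdiff_subset).image φ
  have himage : φ '' Aᶜ = ((hfin.toFinset : Finset ℂ) : Set ℂ)ᶜ := by
    rw [hfin.coe_toFinset]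
    ext z
    have hz : z ∈ φ.target := htarget ▸ mem_univ z
    constructor
    · rintro ⟨x, hx, rfl⟩ ⟨y, hy, hyx⟩
      exact hx (φ.injOn (hdiff hy) (hAsub hx) hyx ▸ hy.1)
    · intro h
      refine ⟨φ.symm z, fun hx => h ⟨φ.symm z, ⟨hx, ?_⟩, φ.right_inv hz⟩, φ.right_inv hz⟩
      have := φ.map_target hz
      rwa [hsource] at this
  refine ⟨hfin.toFinset, ?_, ⟨φ.homeomorphOfImageSubsetSource hAsub himage⟩⟩
  rw [← ncard_eq_toFinset_card _ hfin, (φ.injOn.mono hdiff).ncard_image,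
    ncard_sdiff_singleton_add_one ha hA]

lemma Homeomorph.topological_properties_of_sphere {S : Type*} [TopologicalSpace S]
    (e : S ≃ₜ Metric.sphere (0 : EuclideanSpace ℝ (Fin 3)) 1) :
    CompactSpace S ∧ T2Space S ∧ ConnectedSpace S ∧ Nontrivial S := by
  have hconn : ConnectedSpace (Metric.sphere (0 : EuclideanSpace ℝ (Fin 3)) 1) :=
    Subtype.connectedSpace <| isConnected_sphere
      (by rw [rank_eq_card_basis (PiLp.basisFun 2 ℝ (Fin 3))]; norm_num) 0 zero_le_one
  have hnt : Nontrivial (Metric.sphere (0 : EuclideanSpace ℝ (Fin 3)) 1) := by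
    obtain ⟨x, hx⟩ := (NormedSpace.sphere_nonempty (E := EuclideanSpace ℝ (Fin 3)) (x := 0)
      (r := 1)).mpr zero_le_one
    exact ⟨⟨x, hx⟩, -⟨x, hx⟩, ne_neg_of_mem_unit_sphere ℝ ⟨x, hx⟩⟩
  exact ⟨e.symm.compactSpace, e.isEmbedding.t2Space,
    e.symm.surjective.connectedSpace e.symm.continuous, e.toEquiv.nontrivial⟩

variable {S S' : Type*} [TopologicalSpace S] [TopologicalSpace S'] {f : S → S'} {A : Set S}
  {B : Set S'}

lemma IsBranchedCovering.localDegree_eq_one_of_isCoveringMap [T1Space S'] [ConnectedSpace S']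
    [Nontrivial S'] (hf : IsBranchedCovering f) (hA : IsOpen Aᶜ) (hm : MapsTo f Aᶜ Bᶜ)
    (hcov : IsCoveringMap hm.restrict) {x : S} (hx : x ∉ A) : localDegree f x = 1 := by
  obtain ⟨φ, hxφ, hφ⟩ := hcov.isLocalHomeomorph ⟨x, hx⟩
  refine hf.localDegree_eq_one (hA.isOpenMap_subtype_val.image_mem_nhds
    (φ.open_source.mem_nhds hxφ)) ?_
  rintro _ ⟨a, ha, rfl⟩ _ ⟨b, hb, rfl⟩ hab
  refine congrArg Subtype.val (φ.injOn ha hb ?_)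
  rw [← hφ]
  exact Subtype.ext hab

/-- The Riemann-Hurwitz formula for a branched covering between spheres which is a covering
between the complements of finite sets. -/
theorem IsBranchedCovering.ncard_preimage (hf : IsBranchedCovering f)
    (e : S ≃ₜ Metric.sphere (0 : EuclideanSpace ℝ (Fin 3)) 1)
    (e' : S' ≃ₜ Metric.sphere (0 : EuclideanSpace ℝ (Fin 3)) 1)
    (hA : A.Finite) (hB : B.Finite) (hB' : B.Nonempty) (hAB : f ⁻¹' B = A)
    (hm : MapsTo f Aᶜ Bᶜ) (hcov : IsCoveringMap hm.restrict) :
    A.ncard + 2 * branchedDegree f = branchedDegree f * B.ncard + 2 := by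
  obtain ⟨_, _, _, _⟩ := e.topological_properties_of_sphere
  obtain ⟨_, _, _, _⟩ := e'.topological_properties_of_sphere
  have hA' : A.Nonempty := hAB ▸ hB'.preimage hf.surjective
  have hloc : ∀ x, f x ∉ B → localDegree f x = 1 := fun x hx =>
    hf.localDegree_eq_one_of_isCoveringMap hA.isClosed.isOpen_compl hm hcov
      fun h => hx (by rwa [← hAB] at h)
  have hfiber : ∀ z ∉ B, (f ⁻¹' {z}).ncard = branchedDegree f := fun z hz => by
    rw [← hf.finsum_localDegree hB hloc z, ← finsum_one]
    exact finsum_mem_congr rfl fun x hx => (hloc x (by rwa [show f x = z from hx])).symm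
  have hd : 0 < branchedDegree f := by
    obtain ⟨x⟩ : Nonempty S := inferInstance
    rw [← hf.finsum_localDegree hB hloc (f x),
      finsum_mem_eq_finite_toFinset_sum _ (hf.finite_fiber _)]
    exact Finset.sum_pos (fun y _ => (hf.localDegree_spec y).1) ⟨x, by simp⟩
  obtain ⟨Q, hQ, ⟨g⟩⟩ := exists_homeomorph_compl_finset e hA hA'
  obtain ⟨P, hP, ⟨g'⟩⟩ := exists_homeomorph_compl_finset e' hB hB'
  have key := ((hcov.comp_homeomorph g.symm).homeomorph_comp g').card_punctures hd fun z => by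
    rw [← hfiber (g'.symm z) (g'.symm z).2, ← Nat.card_coe_set_eq]
    refine Nat.card_congr
      { toFun := fun x => ⟨g.symm x, ?_⟩
        invFun := fun x => ⟨g ⟨x, fun hxA => (g'.symm z).2 ?_⟩, ?_⟩
        left_inv := fun x => by simp
        right_inv := fun x => by simp }
    · have := x.2
      exact congrArg Subtype.val (g'.symm_apply_eq.mpr this.symm).symm
    · rw [← hAB] at hxA
      rwa [← show f x = g'.symm z from x.2]
    · rw [mem_preimage, mem_singleton_iff, Function.comp_apply, Function.comp_apply,
        g.symm_apply_apply]
      exact g'.toEquiv.eq_symm_apply.mp (Subtype.ext x.2)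
  rw [← hQ, ← hP]
  linarith

end Spheres

/-! ### Degrees of covers between trees of spheres -/

namespace TreeOfSpheres

variable {X : Type*} [Fintype X] (T : TreeOfSpheres X)

lemma val_pos (v : T.V) : 0 < T.val v := by
  have hcard := (Fintype.card_le_of_injective T.leaf T.leaf_injective).trans' T.three_le_card
  have : Nontrivial T.V := Fintype.one_lt_card_iff_nontrivial.mp (by omega)
  obtain ⟨w, hw⟩ := T.isTree.connected.preconnected.exists_adj_of_nontrivial v
  exact (ncard_pos (toFinite _)).mpr ⟨w, hw⟩

lemma finite_attachingPoints (v : T.IV) : (T.attachingPoints v).Finite := finite_range _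

lemma ncard_attachingPoints (v : T.IV) : (T.attachingPoints v).ncard = T.val v := by
  rw [attachingPoints, ← image_univ, ncard_image_of_injective _ (T.attach_injective v),
    ncard_univ, Nat.card_coe_set_eq]
  rfl

lemma IsLeaf.eq_of_adj {T : TreeOfSpheres X} {u v v' : T.V} (hu : T.IsLeaf u)
    (h : T.graph.Adj v u) (h' : T.graph.Adj v' u) : v = v' := by
  obtain ⟨w, hw⟩ := ncard_eq_one.mp hu
  have h1 : v ∈ T.graph.neighborSet u := h.symm
  have h2 : v' ∈ T.graph.neighborSet u := h'.symm
  rw [hw] at h1 h2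
  exact h1.trans h2.symm

lemma IsLeaf.not_isLeaf_of_adj {T : TreeOfSpheres X} {u v : T.V} (hu : T.IsLeaf u)
    (h : T.graph.Adj v u) : ¬ T.IsLeaf v := by
  obtain ⟨w, hw⟩ := T.exists_internal_adj u hu
  rw [hu.eq_of_adj h hw]
  exact w.2

end TreeOfSpheres

namespace TreeOfSpheres.Cover

variable {Y Z : Type*} [Fintype Y] [Fintype Z] {TY : TreeOfSpheres Y} {TZ : TreeOfSpheres Z}
  (F : TreeOfSpheres.Cover TY TZ)

lemma isLeaf_map_iff (v : TY.V) : TZ.IsLeaf (F.map v) ↔ TY.IsLeaf v :=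
  ⟨fun h => by_contra fun hv => F.map_internal ⟨v, hv⟩ h, F.map_leaf v⟩

lemma preimage_attachingPoints (v : TY.IV) :
    F.f v ⁻¹' TZ.attachingPoints ⟨F.map v.1, F.map_internal v⟩ = TY.attachingPoints v := by
  ext x
  constructor
  · exact fun hx => by_contra fun h => F.mapsTo_compl v h hx
  · rintro ⟨⟨w, hw⟩, rfl⟩
    exact ⟨_, (F.f_attach v w hw).symm⟩

lemma localDegree_eq_one (v : TY.IV) {x : TY.sphere v}
    (hx : F.f v x ∉ TZ.attachingPoints ⟨F.map v.1, F.map_internal v⟩) :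
    localDegree (F.f v) x = 1 := by
  obtain ⟨e⟩ := TY.isSphere v
  obtain ⟨e'⟩ := TZ.isSphere ⟨F.map v.1, F.map_internal v⟩
  obtain ⟨_, _, _, _⟩ := e.topological_properties_of_sphere
  obtain ⟨_, _, _, _⟩ := e'.topological_properties_of_sphere
  refine (F.isBranchedCovering v).localDegree_eq_one_of_isCoveringMap
    (TY.finite_attachingPoints v).isClosed.isOpen_compl (F.mapsTo_compl v) (F.isCoveringMap v) ?_
  rwa [← F.preimage_attachingPoints v]

open Classical in
/-- The local degree of the cover at the edge `{v, u}`, seen from the internal vertex `v`; it is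
`0` if `v` is a leaf or if `{v, u}` is not an edge. -/
noncomputable def edgeDegree (v u : TY.V) : ℕ :=
  if h : ¬ TY.IsLeaf v ∧ TY.graph.Adj v u then
    localDegree (F.f ⟨v, h.1⟩) (TY.attach ⟨v, h.1⟩ ⟨u, h.2⟩) else 0

lemma edgeDegree_of_adj (v : TY.IV) {u : TY.V} (h : TY.graph.Adj v.1 u) :
    F.edgeDegree v.1 u = localDegree (F.f v) (TY.attach v ⟨u, h⟩) :=
  dif_pos (⟨v.2, h⟩ : ¬ TY.IsLeaf v.1 ∧ TY.graph.Adj v.1 u)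

lemma edgeDegree_of_not_adj {v u : TY.V} (h : ¬ TY.graph.Adj v u) : F.edgeDegree v u = 0 :=
  dif_neg fun h' => h h'.2

lemma edgeDegree_comm {v u : TY.V} (hv : ¬ TY.IsLeaf v) (hu : ¬ TY.IsLeaf u) :
    F.edgeDegree v u = F.edgeDegree u v := by
  by_cases h : TY.graph.Adj v u
  · rw [F.edgeDegree_of_adj ⟨v, hv⟩ h, F.edgeDegree_of_adj ⟨u, hu⟩ h.symm]
    exact F.localDegree_eq ⟨v, hv⟩ ⟨u, hu⟩ h
  · rw [F.edgeDegree_of_not_adj h, F.edgeDegree_of_not_adj fun h' => h h'.symm]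

open Classical in
/-- The degree of an internal vertex is the sum of the local degrees at the edges over a given
edge. -/
lemma deg_eq_sum_edgeDegree {v : TY.V} (hv : ¬ TY.IsLeaf v) {w : TZ.V}
    (hw : TZ.graph.Adj (F.map v) w) :
    F.deg v = ∑ u : TY.V with F.map u = w, F.edgeDegree v u := by
  let v' : TY.IV := ⟨v, hv⟩
  let z := TZ.attach ⟨F.map v, F.map_internal v'⟩ ⟨w, hw⟩
  obtain ⟨e⟩ := TY.isSphere v'
  obtain ⟨e'⟩ := TZ.isSphere ⟨F.map v, F.map_internal v'⟩
  obtain ⟨_, _, _, _⟩ := e.topological_properties_of_sphere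
  obtain ⟨_, _, _, _⟩ := e'.topological_properties_of_sphere
  have hdeg : F.deg v = branchedDegree (F.f v') := dif_neg hv
  have hfiber : F.f v' ⁻¹' {z} = TY.attach v' '' {u | F.map u.1 = w} := by
    ext x
    constructor
    · intro hx
      have hxA : x ∈ TY.attachingPoints v' := by
        rw [← F.preimage_attachingPoints v']
        exact ⟨⟨w, hw⟩, (show F.f v' x = z from hx).symm⟩
      obtain ⟨⟨u, hu⟩, rfl⟩ := hxA
      refine ⟨⟨u, hu⟩, ?_, rfl⟩
      have := (F.f_attach v' u hu).symm.trans hx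
      exact congrArg Subtype.val (TZ.attach_injective _ this)
    · rintro ⟨⟨u, hu⟩, hw', rfl⟩
      refine (F.f_attach v' u hu).trans (congrArg _ (Subtype.ext hw'))
  rw [hdeg, ← (F.isBranchedCovering v').finsum_localDegree
    (TZ.finite_attachingPoints ⟨F.map v, F.map_internal v'⟩)
    (fun x hx => F.localDegree_eq_one v' hx) z, hfiber,
    finsum_mem_image (TY.attach_injective v').injOn]
  have h1 : ∑ᶠ u ∈ {u : TY.graph.neighborSet v | F.map u.1 = w},
      localDegree (F.f v') (TY.attach v' u) =
      ∑ᶠ u ∈ {u : TY.graph.neighborSet v | F.map u.1 = w}, F.edgeDegree v u.1 :=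
    finsum_mem_congr rfl fun u _ => (F.edgeDegree_of_adj v' u.2).symm
  rw [h1, ← finsum_mem_image (f := F.edgeDegree v) Subtype.val_injective.injOn]
  refine finsum_mem_eq_sum_of_inter_support_eq _ (Set.ext fun u => ?_)
  simp only [mem_inter_iff, mem_image, mem_ofPred_eq, Function.mem_support, Finset.coe_filter,
    Finset.mem_univ, true_and]
  refine and_congr_left fun hu => ⟨?_, fun h => ⟨⟨u, ?_⟩, h, rfl⟩⟩
  · rintro ⟨u', hu', rfl⟩
    exact hu'
  · exact by_contra fun h' => hu (F.edgeDegree_of_not_adj h')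

open Classical in
/-- The degree of a leaf is the local degree at its edge. -/
lemma deg_eq_sum_of_isLeaf {u : TY.V} (hu : TY.IsLeaf u) {w : TZ.V}
    (hw : TZ.graph.Adj w (F.map u)) :
    F.deg u = ∑ v : TY.V with F.map v = w, F.edgeDegree v u := by
  have hspec := (TY.exists_internal_adj u hu).choose_spec
  set v := (TY.exists_internal_adj u hu).choose
  have hdeg : F.deg u = F.edgeDegree v.1 u := by
    rw [F.edgeDegree_of_adj v hspec]
    exact dif_pos hu
  have hmem : F.map v.1 = w := (F.map_leaf u hu).eq_of_adj (F.map.map_adj hspec) hw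
  rw [hdeg, Finset.sum_eq_single v.1]
  · exact fun v' _ hne => F.edgeDegree_of_not_adj fun h => hne (hu.eq_of_adj h hspec)
  · intro h
    rw [Finset.mem_filter] at h
    exact absurd ⟨Finset.mem_univ _, hmem⟩ h

/-- For adjacent `w` and `w'`, both numbers are the sum of the local degrees at the edges over
`{w, w'}`. -/
lemma degreeOver_eq_of_adj {w w' : TZ.V} (h : TZ.graph.Adj w w') :
    F.degreeOver w = F.degreeOver w' := by
  classical
  wlog hw : ¬ TZ.IsLeaf w generalizing w w'
  · exact (this h.symm ((not_not.mp hw).not_isLeaf_of_adj h.symm)).symm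
  have hover : ∀ {v w}, F.map v = w → ¬ TZ.IsLeaf w → ¬ TY.IsLeaf v := by
    rintro v _ rfl hw
    rwa [← F.isLeaf_map_iff]
  have h1 : F.degreeOver w =
      ∑ v : TY.V with F.map v = w, ∑ u : TY.V with F.map u = w', F.edgeDegree v u := by
    refine Finset.sum_congr rfl fun v hv => ?_
    obtain rfl := (Finset.mem_filter.mp hv).2
    exact F.deg_eq_sum_edgeDegree (hover rfl hw) h
  rw [h1, Finset.sum_comm]
  refine Finset.sum_congr rfl fun u hu => ?_
  obtain rfl := (Finset.mem_filter.mp hu).2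
  by_cases hul : TY.IsLeaf u
  · exact (F.deg_eq_sum_of_isLeaf hul h).symm
  · rw [F.deg_eq_sum_edgeDegree hul h.symm]
    refine Finset.sum_congr rfl fun v hv => ?_
    exact F.edgeDegree_comm (hover (Finset.mem_filter.mp hv).2 hw) hul

theorem degreeOver_eq_degree (w : TZ.V) : F.degreeOver w = F.degree := by
  unfold degree
  generalize Classical.choice TZ.isTree.connected.nonempty = w'
  obtain ⟨p⟩ := TZ.isTree.connected.preconnected w w'
  induction p with
  | nil => rfl
  | cons h _ ih => exact (F.degreeOver_eq_of_adj h).trans ih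

/-- The Riemann-Hurwitz formula on the sphere at an internal vertex. -/
lemma two_sub_val_of_not_isLeaf {v : TY.V} (hv : ¬ TY.IsLeaf v) :
    (2 - TY.val v : ℤ) = F.deg v * (2 - TZ.val (F.map v)) := by
  let v' : TY.IV := ⟨v, hv⟩
  obtain ⟨e⟩ := TY.isSphere v'
  obtain ⟨e'⟩ := TZ.isSphere ⟨F.map v, F.map_internal v'⟩
  have hne : (TZ.attachingPoints ⟨F.map v, F.map_internal v'⟩).Nonempty := by
    rw [← ncard_pos (TZ.finite_attachingPoints _), ncard_attachingPoints]
    exact TZ.val_pos _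
  have key := (F.isBranchedCovering v').ncard_preimage e e' (TY.finite_attachingPoints v')
    (TZ.finite_attachingPoints _) hne (F.preimage_attachingPoints v') (F.mapsTo_compl v')
    (F.isCoveringMap v')
  rw [ncard_attachingPoints, ncard_attachingPoints] at key
  have hdeg : F.deg v = branchedDegree (F.f v') := dif_neg hv
  rw [← hdeg] at key
  have key' : (TY.val v : ℤ) + 2 * F.deg v = F.deg v * TZ.val (F.map v) + 2 := by
    exact_mod_cast key
  linarith

open Classical in
/-- The formula of the theorem holds vertex by vertex. -/
lemma two_sub_val (v : TY.V) : (2 - TY.val v : ℤ) =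
    F.deg v * (2 - TZ.val (F.map v)) - if TY.IsLeaf v then (F.deg v - 1 : ℤ) else 0 := by
  by_cases hv : TY.IsLeaf v
  · rw [if_pos hv, show TY.val v = 1 from hv, show TZ.val (F.map v) = 1 from F.map_leaf v hv]
    push_cast
    ring
  · rw [if_neg hv, sub_zero, F.two_sub_val_of_not_isLeaf hv]

lemma one_le_deg_of_isLeaf {v : TY.V} (hv : TY.IsLeaf v) : 1 ≤ F.deg v := by
  rw [show F.deg v = F.leafDegree v hv from dif_pos hv]
  exact ((F.isBranchedCovering _).localDegree_spec _).1

open Classical in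
/-- Leaves which are not critical contribute zero, so the sum may be taken over all leaves. -/
lemma sum_mult_eq (T' : Set TY.Total) :
    ∑ y : Y with F.IsCriticalLeaf y ∧ Sum.inl (TY.leaf y) ∈ T', F.mult y =
      ∑ v : TY.V with Sum.inl v ∈ T', if TY.IsLeaf v then (F.deg v - 1 : ℤ) else 0 := by
  have hleaf : ∀ v, TY.IsLeaf v ↔ v ∈ range TY.leaf := fun v => by
    rw [TY.range_leaf]
    rfl
  have h1 : ∑ y : Y with F.IsCriticalLeaf y ∧ Sum.inl (TY.leaf y) ∈ T', F.mult y =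
      ∑ y : Y with Sum.inl (TY.leaf y) ∈ T', F.mult y := by
    refine Finset.sum_subset (fun y hy => ?_) fun y hy hy' => ?_
    · simp only [Finset.mem_filter, Finset.mem_univ, true_and] at hy ⊢
      exact hy.2
    · simp only [Finset.mem_filter, Finset.mem_univ, true_and] at hy hy'
      have h2 := F.one_le_deg_of_isLeaf ((hleaf _).mpr ⟨y, rfl⟩)
      have h3 : ¬ 1 < F.deg (TY.leaf y) := fun h => hy' ⟨h, hy⟩
      have h4 : F.deg (TY.leaf y) = 1 := by omega
      simp [mult, h4]
  rw [h1, ← Finset.sum_filter, Finset.filter_filter]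
  refine Finset.sum_bij (fun y _ => TY.leaf y) (fun y hy => ?_)
    (fun _ _ _ _ h => TY.leaf_injective h) (fun v hv => ?_) fun _ _ => rfl
  · simp only [Finset.mem_filter, Finset.mem_univ, true_and] at hy ⊢
    exact ⟨hy, (hleaf _).mpr ⟨y, rfl⟩⟩
  · simp only [Finset.mem_filter, Finset.mem_univ, true_and] at hv
    obtain ⟨y, rfl⟩ := (hleaf v).mp hv.2
    exact ⟨y, by simpa using hv.1, rfl⟩

end TreeOfSpheres.Cover

open Classical in
/-- Riemann-Hurwitz formula for covers between trees of spheres. The number `D_w` does not depend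
on the vertex `w`, so the degree of the cover is well defined, and the formula holds for every set
`T''` of vertices and edges of the target, in particular for every sub-graph. -/
theorem proposition2p22 {Y Z : Type*} [Fintype Y] [Fintype Z]
    (TY : TreeOfSpheres Y) (TZ : TreeOfSpheres Z) (F : TreeOfSpheres.Cover TY TZ) :
    (∀ w : TZ.V, F.degreeOver w = F.degree) ∧
    ∀ (T'' : Set TZ.Total) (T' : Set TY.Total), T' = F.totalMap ⁻¹' T'' →
      TY.char T' = (F.degree : ℤ) * TZ.char T'' -
        ∑ y : Y with F.IsCriticalLeaf y ∧ Sum.inl (TY.leaf y) ∈ T', F.mult y := by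
  refine ⟨F.degreeOver_eq_degree, ?_⟩
  rintro T'' T' rfl
  rw [F.sum_mult_eq]
  unfold TreeOfSpheres.char
  rw [Finset.sum_congr rfl fun v _ => F.two_sub_val v, Finset.sum_sub_distrib, Finset.mul_sum]
  congr 1
  rw [← Finset.sum_fiberwise_of_maps_to (g := F.map) (t := {w : TZ.V | Sum.inl w ∈ T''})
    fun v hv => by
    simp only [Finset.mem_filter, Finset.mem_univ, true_and] at hv ⊢
    exact hv]
  refine Finset.sum_congr rfl fun w hw => ?_
  rw [← F.degreeOver_eq_degree w, TreeOfSpheres.Cover.degreeOver, Nat.cast_sum, Finset.sum_mul,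
    Finset.filter_filter]
  refine Finset.sum_congr (Finset.filter_congr fun v _ => ⟨fun h => h.2, ?_⟩) fun v hv => ?_
  · rintro rfl
    exact ⟨(Finset.mem_filter.mp hw).2, rfl⟩
  · rw [(Finset.mem_filter.mp hv).2]
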